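/- Let $K$ be a field of characteristic zero. For a $\mathbb Z$-graded $K$-vector space $\mathcal H$ let $C(\mathcal H)=\bigoplus_{n\ge0}\mathcal H^{\otimes n}$ be the tensor coalgebra with the deconcatenation coproduct. An $A_\infty$-algebra $(\mathcal H,\mathfrak m)$ is a degree one coderivation $\mathfrak m$ of $C(\mathcal H)$ with $\mathfrak m^2=0$ and $m_0=0$, where $m_k:\mathcal H^{\otimes k}\to\mathcal H$ denotes the components of $\mathfrak m$; an $A_\infty$-morphism $\mathcal F:(\mathcal H,\mathfrak m)\to(\mathcal H',\mathfrak m')$ is a degree zero cohomomorphism $C(\mathcal H)\to C(\mathcal H')$ with $\mathcal F\mathfrak m=\mathfrak m'\mathcal F$ and $f_0=0$, that is, $\mathcal F(1)=1$ (components $f_k$). It is an $A_\infty$-quasi-isomorphism if $f_1$ induces an isomorphism of the $m_1$-cohomologies, and an $A_\infty$-isomorphism if $f_1$ is bijective. An $A_\infty$-algebra is minimal if $m_1=0$, and linear contractible if $m_k=0$ for $k\ge2$ and its $m_1$-cohomology vanishes. A minimal model of $(\mathcal H,\mathfrak m)$ is a minimal $A_\infty$-algebra $(\mathcal H^p,\tilde{\mathfrak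 m}^p)$ together with an $A_\infty$-quasi-isomorphism $\tilde{\mathcal F}^p:(\mathcal H^p,\tilde{\mathfrak m}^p)\to(\mathcal H,\mathfrak m)$ (so that $\mathcal H^p$ is identified with the $m_1$-cohomology of $\mathcal H$). Let $(\mathcal H,\mathfrak m)$ be an $A_\infty$-algebra, and let $(\mathcal H^p,\tilde{\mathfrak m}^p)$, $\tilde{\mathcal F}^p$ be a minimal model of it. Then: 1. (Uniqueness) If $(\mathcal H'^p,\tilde{\mathfrak m}'^p)$, $\tilde{\mathcal F}'^p$ is another minimal model of $(\mathcal H,\mathfrak m)$, then there is an $A_\infty$-isomorphism $(\mathcal H^p,\tilde{\mathfrak m}^p)\to(\mathcal H'^p,\tilde{\mathfrak m}'^p)$. In particular this holds for any two minimal models with the same underlying space $\mathcal H^p$. 2. (Factorization) There are a linear contractible $A_\infty$-algebra $(\mathcal C,\mathfrak c)$ and, with $(\mathcal H_{dc},\mathfrak m_{dc})$ the direct sum $A_\infty$-algebra $(\mathcal H^p,\tilde{\mathfrak m}^p)\oplus(\mathcal C,\mathfrak c)$, an $A_\infty$-isomorphism $\mathcal F_{dc}:(\mathcal H_{dc},\mathfrak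 m_{dc})\to(\mathcal H,\mathfrak m)$ such that $\tilde{\mathcal F}^p=\mathcal F_{dc}\circ\iota$, where the $A_\infty$-morphism $\iota:(\mathcal H^p,\tilde{\mathfrak m}^p)\to(\mathcal H_{dc},\mathfrak m_{dc})$ is the inclusion (with zero higher components). 3. (Inverse) There is an $A_\infty$-quasi-isomorphism $\mathcal G:(\mathcal H,\mathfrak m)\to(\mathcal H^p,\tilde{\mathfrak m}^p)$ inverse to $\tilde{\mathcal F}^p$: the maps induced by $\mathcal G$ and $\tilde{\mathcal F}^p$ on cohomology are inverse to each other, and moreover $\mathcal G\circ\tilde{\mathcal F}^p=\mathrm{Id}$. -/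

import Mathlib

open scoped TensorProduct

universe w u v v'

noncomputable section

namespace AInf

/-! ### Graded vector spaces

A `ℤ`-graded vector space is a `K`-module `H` with submodules `ℋ k` (`k : ℤ`) of which it is the
internal direct sum (`DirectSum.Decomposition ℋ`). -/

section Graded

variable {K : Type w} [Field K]
variable {V : Type v} [AddCommGroup V] [Module K V]
variable {C : Type v'} [AddCommGroup C] [Module K C]

/-- The degree involution `x ↦ (-1)^k x` for `x` homogeneous of degree `k`. -/
def signMap (ℋ : ℤ → Submodule K V) [DirectSum.Decomposition ℋ] : V →ₗ[K] V :=
  (DirectSum.toModule K ℤ V fun k => ((k.negOnePow : ℤˣ) : ℤ) • (ℋ k).subtype) ∘ₗ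
    (DirectSum.decomposeLinearEquiv ℋ).toLinearMap

theorem signMap_of_mem (ℋ : ℤ → Submodule K V) [DirectSum.Decomposition ℋ] {k : ℤ} {x : V}
    (hx : x ∈ ℋ k) : signMap ℋ x = ((k.negOnePow : ℤˣ) : ℤ) • x := by
  have h := DirectSum.decomposeLinearEquiv_apply_coe (R := K) ℋ k ⟨x, hx⟩
  simp only at h
  simp [signMap, h]

/-- The grading of the direct sum `V ⊕ C` of two graded vector spaces. -/
def prodGrading (𝒱 : ℤ → Submodule K V) (𝒞 : ℤ → Submodule K C) : ℤ → Submodule K (V × C) :=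
  fun k => (𝒱 k).prod (𝒞 k)

instance prodDecomposition (𝒱 : ℤ → Submodule K V) (𝒞 : ℤ → Submodule K C)
    [DirectSum.Decomposition 𝒱] [DirectSum.Decomposition 𝒞] :
    DirectSum.Decomposition (prodGrading 𝒱 𝒞) :=
  DirectSum.Decomposition.ofLinearMap (R := K) (prodGrading 𝒱 𝒞)
    (LinearMap.coprod
      ((DirectSum.toModule K ℤ _ fun k =>
        DirectSum.lof K ℤ (fun k => prodGrading 𝒱 𝒞 k) k ∘ₗ
          ((LinearMap.inl K V C).restrict (p := 𝒱 k) (q := prodGrading 𝒱 𝒞 k)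
            fun _ hx => ⟨hx, (𝒞 k).zero_mem⟩)) ∘ₗ
        (DirectSum.decomposeLinearEquiv 𝒱).toLinearMap)
      ((DirectSum.toModule K ℤ _ fun k =>
        DirectSum.lof K ℤ (fun k => prodGrading 𝒱 𝒞 k) k ∘ₗ
          ((LinearMap.inr K V C).restrict (p := 𝒞 k) (q := prodGrading 𝒱 𝒞 k)
            fun _ hx => ⟨(𝒱 k).zero_mem, hx⟩)) ∘ₗ
        (DirectSum.decomposeLinearEquiv 𝒞).toLinearMap))
    (by
      refine LinearMap.prod_ext ?_ ?_
      · refine DirectSum.decompose_lhom_ext (R := K) 𝒱 fun k => LinearMap.ext fun x => ?_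
        simp
        rfl
      · refine DirectSum.decompose_lhom_ext (R := K) 𝒞 fun k => LinearMap.ext fun x => ?_
        simp
        rfl)
    (by
      refine DirectSum.linearMap_ext K fun k => LinearMap.ext fun x => ?_
      obtain ⟨⟨a, b⟩, ha, hb⟩ := x
      have h1 := DirectSum.decomposeLinearEquiv_apply_coe (R := K) 𝒱 k ⟨a, ha⟩
      have h2 := DirectSum.decomposeLinearEquiv_apply_coe (R := K) 𝒞 k ⟨b, hb⟩
      simp only at h1 h2
      simp only [LinearMap.coe_comp, Function.comp_apply, DirectSum.coeLinearMap_lof,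
        LinearMap.coprod_apply, LinearEquiv.coe_coe, h1, h2, DirectSum.toModule_lof,
        LinearMap.id_coe, id_eq]
      rw [← map_add]
      congr 1
      exact Subtype.ext (Prod.ext (add_zero a) (zero_add b)))

end Graded

/-! ### The tensor coalgebra `C(H) = ⨁ₙ H^{⊗ n}` -/

section Coalgebra

variable (K : Type w) [Field K] (H : Type u) [AddCommGroup H] [Module K H]

/-- The underlying vector space of `C(H)`; the word `o₁ ⋯ oₙ` is `ι o₁ * ⋯ * ι oₙ`. -/
abbrev Words : Type (max w u) := TensorAlgebra K H

/-- Left concatenation by a letter, acting on pairs `(w, z)` with `w : C(H)`, `z : C(H) ⊗ C(H)` by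
`(w, z) ↦ (o w, 1 ⊗ o w + (o ⊗ 1) z)`. It is the recursion step of the coproduct. -/
def deconcatStep : H →ₗ[K] Module.End K (Words K H × (Words K H ⊗[K] Words K H)) where
  toFun o :=
    LinearMap.prod
      (LinearMap.mulLeft K (TensorAlgebra.ι K o) ∘ₗ LinearMap.fst K _ _)
      (TensorProduct.mk K (Words K H) (Words K H) 1 ∘ₗ
          LinearMap.mulLeft K (TensorAlgebra.ι K o) ∘ₗ LinearMap.fst K _ _ +
        LinearMap.rTensor (Words K H) (LinearMap.mulLeft K (TensorAlgebra.ι K o)) ∘ₗ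
          LinearMap.snd K _ _)
  map_add' a b := by
    refine LinearMap.ext fun x => ?_
    refine Prod.ext ?_ ?_
    · simp [add_mul]
    · have : LinearMap.mulLeft K (TensorAlgebra.ι K a + TensorAlgebra.ι K b) =
          LinearMap.mulLeft K (TensorAlgebra.ι K a) + LinearMap.mulLeft K (TensorAlgebra.ι K b) := by
        ext; simp [add_mul]
      simp only [map_add, this, LinearMap.rTensor_add]
      simp [TensorProduct.tmul_add]
      abel
  map_smul' r a := by
    refine LinearMap.ext fun x => ?_
    refine Prod.ext ?_ ?_
    · simp
    · have : LinearMap.mulLeft K (r • TensorAlgebra.ι K a) =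
          r • LinearMap.mulLeft K (TensorAlgebra.ι K a) := by
        ext; simp
      simp only [map_smul, this, LinearMap.rTensor_smul]
      simp

/-- The deconcatenation coproduct
`Δ(o₁ ⋯ oₙ) = ∑_{k=0}^{n} (o₁ ⋯ o_k) ⊗ (o_{k+1} ⋯ oₙ)` on `C(H)`; see `deconcat_list`. -/
def deconcat : Words K H →ₗ[K] Words K H ⊗[K] Words K H :=
  LinearMap.snd K _ _ ∘ₗ
    LinearMap.applyₗ ((1 : Words K H), (1 : Words K H) ⊗ₜ[K] (1 : Words K H)) ∘ₗ
      (TensorAlgebra.lift K (deconcatStep K H)).toLinearMap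

variable {K H}

theorem deconcat_aux (x : Words K H) :
    TensorAlgebra.lift K (deconcatStep K H) x (1, 1 ⊗ₜ[K] 1) = (x, deconcat K H x) := by
  refine Prod.ext ?_ rfl
  have key : ∀ (x : Words K H) (p : Words K H × (Words K H ⊗[K] Words K H)),
      (TensorAlgebra.lift K (deconcatStep K H) x p).1 = x * p.1 := by
    intro x
    induction x using TensorAlgebra.induction with
    | algebraMap r => intro p; simp [Algebra.smul_def]
    | ι o => intro p; simp [deconcatStep]
    | mul a b ha hb => intro p; simp [ha, hb, mul_assoc]
    | add a b ha hb => intro p; simp [ha, hb, add_mul]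
  simpa using key x (1, 1 ⊗ₜ[K] 1)

@[simp]
theorem deconcat_one : deconcat K H 1 = 1 ⊗ₜ[K] 1 := by
  have := deconcat_aux (K := K) (H := H) 1
  simpa using (congrArg Prod.snd this).symm

theorem deconcat_ι_mul (o : H) (x : Words K H) :
    deconcat K H (TensorAlgebra.ι K o * x) =
      1 ⊗ₜ[K] (TensorAlgebra.ι K o * x) +
        LinearMap.rTensor (Words K H) (LinearMap.mulLeft K (TensorAlgebra.ι K o))
          (deconcat K H x) := by
  have h := congrArg Prod.snd (deconcat_aux (K := K) (H := H) (TensorAlgebra.ι K o * x))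
  rw [map_mul, Module.End.mul_apply, deconcat_aux x] at h
  simpa [deconcatStep] using h.symm

/-- The coproduct on words. -/
theorem deconcat_list (l : List H) :
    deconcat K H ((l.map (TensorAlgebra.ι K)).prod) =
      ∑ k ∈ Finset.range (l.length + 1),
        ((l.take k).map (TensorAlgebra.ι K)).prod ⊗ₜ[K]
          ((l.drop k).map (TensorAlgebra.ι K)).prod := by
  induction l with
  | nil => simp
  | cons o l ih =>
    rw [List.map_cons, List.prod_cons, deconcat_ι_mul, ih, List.length_cons,
      Finset.sum_range_succ' _ (l.length + 1), add_comm]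
    simp

theorem words_induction {P : Words K H → Prop} (one : P 1)
    (cons : ∀ o x, P x → P (TensorAlgebra.ι K o * x))
    (add : ∀ x y, P x → P y → P (x + y)) (smul : ∀ (r : K) x, P x → P (r • x))
    (x : Words K H) : P x := by
  have key : ∀ (x y : Words K H), P y → P (x * y) := by
    intro x
    induction x using TensorAlgebra.induction with
    | algebraMap r => intro y hy; rw [← Algebra.smul_def]; exact smul r y hy
    | ι o => intro y hy; exact cons o y hy
    | mul a b ha hb => intro y hy; rw [mul_assoc]; exact ha _ (hb _ hy)
    | add a b ha hb => intro y hy; rw [add_mul]; exact add _ _ (ha _ hy) (hb _ hy)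
  simpa using key x 1 one

theorem ιInv_one : TensorAlgebra.ιInv (1 : Words K H) = 0 := by
  let _ : Module Kᵐᵒᵖ H := Module.compHom _ ((RingHom.id K).fromOpposite mul_comm)
  have _ : IsCentralScalar K H := ⟨fun r m => rfl⟩
  have e : TensorAlgebra.ιInv (1 : Words K H) = (TensorAlgebra.toTrivSqZeroExt 1).snd := rfl
  rw [e, map_one, TrivSqZeroExt.snd_one]

theorem ιInv_ι_mul (o : H) (x : Words K H) :
    TensorAlgebra.ιInv (TensorAlgebra.ι K o * x) = TensorAlgebra.algebraMapInv x • o := by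
  let _ : Module Kᵐᵒᵖ H := Module.compHom _ ((RingHom.id K).fromOpposite mul_comm)
  have _ : IsCentralScalar K H := ⟨fun r m => rfl⟩
  have h : ∀ x : Words K H,
      (TensorAlgebra.toTrivSqZeroExt x).fst = TensorAlgebra.algebraMapInv x := by
    intro x
    have : (TrivSqZeroExt.fstHom K K H).comp TensorAlgebra.toTrivSqZeroExt =
        (TensorAlgebra.algebraMapInv : Words K H →ₐ[K] K) := by
      refine TensorAlgebra.hom_ext (LinearMap.ext fun o => ?_)
      simp [TensorAlgebra.algebraMapInv]
    exact DFunLike.congr_fun this x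
  have e : TensorAlgebra.ιInv (TensorAlgebra.ι K o * x) =
      (TensorAlgebra.toTrivSqZeroExt (TensorAlgebra.ι K o * x)).snd := rfl
  rw [e, map_mul, TensorAlgebra.toTrivSqZeroExt_ι, TrivSqZeroExt.snd_mul, h]
  simp

/-- The counit identity of the deconcatenation coproduct. -/
theorem counit_deconcat (x : Words K H) :
    TensorProduct.lid K (Words K H)
      (LinearMap.rTensor (Words K H)
        (TensorAlgebra.algebraMapInv : Words K H →ₐ[K] K).toLinearMap (deconcat K H x)) = x := by
  induction x using words_induction with
  | one => simp
  | cons o x ih =>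
    rw [deconcat_ι_mul, map_add, map_add, ← LinearMap.comp_apply, ← LinearMap.rTensor_comp]
    have : (TensorAlgebra.algebraMapInv : Words K H →ₐ[K] K).toLinearMap ∘ₗ
        LinearMap.mulLeft K (TensorAlgebra.ι K o) = 0 := by
      ext y; simp [TensorAlgebra.algebraMapInv]
    rw [this]
    simp
  | add x y hx hy => simp only [map_add, hx, hy]
  | smul r x hx => simp only [map_smul, hx]

/-- Concatenating the first letter with the remaining word recovers a word of positive length. -/
theorem concat_deconcat (x : Words K H) :
    LinearMap.mul' K (Words K H)
      (LinearMap.rTensor (Words K H)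
        (TensorAlgebra.ι K ∘ₗ TensorAlgebra.ιInv) (deconcat K H x)) =
      x - algebraMap K _ (TensorAlgebra.algebraMapInv x) := by
  induction x using words_induction with
  | one => simp [ιInv_one]
  | cons o x ih =>
    rw [deconcat_ι_mul, map_add, map_add, ← LinearMap.comp_apply
      (LinearMap.rTensor (Words K H) (TensorAlgebra.ι K ∘ₗ TensorAlgebra.ιInv)),
      ← LinearMap.rTensor_comp]
    have e : (TensorAlgebra.ι K ∘ₗ TensorAlgebra.ιInv) ∘ₗ
        LinearMap.mulLeft K (TensorAlgebra.ι K o) =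
        LinearMap.toSpanSingleton K (Words K H) (TensorAlgebra.ι K o) ∘ₗ
          (TensorAlgebra.algebraMapInv : Words K H →ₐ[K] K).toLinearMap := by
      ext y; simp [ιInv_ι_mul]
    have f : ∀ z : K ⊗[K] Words K H, LinearMap.mul' K (Words K H)
        (LinearMap.rTensor (Words K H)
          (LinearMap.toSpanSingleton K (Words K H) (TensorAlgebra.ι K o)) z) =
        TensorAlgebra.ι K o * TensorProduct.lid K (Words K H) z := by
      intro z
      induction z using TensorProduct.induction_on with
      | zero => simp
      | tmul r y => simp
      | add a b ha hb => simp only [map_add, ha, hb, mul_add]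
    rw [e, LinearMap.rTensor_comp (Words K H) (LinearMap.toSpanSingleton _ _ _),
      LinearMap.comp_apply (LinearMap.rTensor (Words K H) (LinearMap.toSpanSingleton _ _ _)), f,
      counit_deconcat]
    simp [ιInv_one, TensorAlgebra.algebraMapInv]
  | add x y hx hy => simp only [map_add, hx, hy]; abel
  | smul r x hx => simp only [map_smul, hx, smul_sub, Algebra.algebraMap_eq_smul_one, smul_assoc]

/-- Primitive elements of `C(H)` lie in `H`. -/
theorem eq_ι_of_primitive {x : Words K H}
    (hx : deconcat K H x = x ⊗ₜ[K] 1 + 1 ⊗ₜ[K] x) :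
    x = TensorAlgebra.ι K (TensorAlgebra.ιInv x) := by
  have h1 := counit_deconcat x
  have h2 := concat_deconcat x
  rw [hx] at h1 h2
  simp only [map_add, LinearMap.rTensor_tmul, AlgHom.toLinearMap_apply, TensorProduct.lid_tmul,
    map_one, one_smul, add_eq_right] at h1
  have h3 : TensorAlgebra.algebraMapInv x = 0 := by
    have := congrArg (TensorAlgebra.algebraMapInv) h1
    simpa using this
  simpa [h3, ιInv_one] using h2.symm

theorem deconcat_ι (o : H) :
    deconcat K H (TensorAlgebra.ι K o) =
      TensorAlgebra.ι K o ⊗ₜ[K] 1 + 1 ⊗ₜ[K] TensorAlgebra.ι K o := by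
  have := deconcat_ι_mul (K := K) o 1
  rw [mul_one, deconcat_one] at this
  rw [this]
  simp [add_comm]

/-- The degree `d` part of `C(H)`, spanned by the words `o₁ ⋯ oₙ` (`n ≥ 0`) of homogeneous
elements whose degrees add up to `d`. -/
def wordGrading (ℋ : ℤ → Submodule K H) (d : ℤ) : Submodule K (Words K H) :=
  Submodule.span K {x | ∃ (n : ℕ) (e : Fin n → ℤ) (o : Fin n → H),
    (∀ i, o i ∈ ℋ (e i)) ∧ ∑ i, e i = d ∧ x = TensorAlgebra.tprod K H n o}

/-- The degree involution `x ↦ (-1)^d x` (`x` of degree `d`) on `C(H)`. -/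
def wordSign (ℋ : ℤ → Submodule K H) [DirectSum.Decomposition ℋ] :
    Words K H →ₐ[K] Words K H :=
  TensorAlgebra.lift K (TensorAlgebra.ι K ∘ₗ signMap ℋ)

end Coalgebra

/-! ### `A_∞`-algebras -/

section Algebras

variable {K : Type w} [Field K]
variable {H : Type u} [AddCommGroup H] [Module K H]

/-- An `A_∞`-algebra structure on the graded vector space `(H, ℋ)`: a coderivation `𝔪` of degree
one on the tensor coalgebra `C(H)` with `𝔪² = 0` and `m₀ = 0`. -/
structure AInfStructure (ℋ : ℤ → Submodule K H) [DirectSum.Decomposition ℋ] where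
  /-- the codifferential `𝔪` -/
  d : Words K H →ₗ[K] Words K H
  degree_one : ∀ (p : ℤ) (x : Words K H), x ∈ wordGrading ℋ p → d x ∈ wordGrading ℋ (p + 1)
  /-- `Δ 𝔪 = (𝔪 ⊗ 1) Δ + (1 ⊗ 𝔪) Δ` with `(1 ⊗ 𝔪)(x ⊗ y) = (-1)^x x ⊗ 𝔪(y)` -/
  coderivation : ∀ x : Words K H,
    deconcat K H (d x) =
      TensorProduct.map d LinearMap.id (deconcat K H x) +
        TensorProduct.map (wordSign ℋ).toLinearMap d (deconcat K H x)
  square_zero : ∀ x : Words K H, d (d x) = 0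
  /-- `m₀ = 0`, as `m₀(1) = 𝔪(1)` -/
  map_one : d 1 = 0

namespace AInfStructure

variable {ℋ : ℤ → Submodule K H} [DirectSum.Decomposition ℋ] (m : AInfStructure ℋ)

/-- The multilinear map `m_k : H^{⊗ k} → H`, the `H`-component of `𝔪` on words of length `k`. -/
def op (k : ℕ) : MultilinearMap K (fun _ : Fin k => H) H :=
  (TensorAlgebra.ιInv ∘ₗ m.d).compMultilinearMap (TensorAlgebra.tprod K H k)

/-- `Q = m₁` as a linear map. -/
def m₁ : H →ₗ[K] H := TensorAlgebra.ιInv ∘ₗ m.d ∘ₗ TensorAlgebra.ι K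

theorem op_one (o : Fin 1 → H) : m.op 1 o = m.m₁ (o 0) := by
  simp [op, m₁]

theorem d_ι (o : H) : m.d (TensorAlgebra.ι K o) = TensorAlgebra.ι K (m.m₁ o) := by
  refine eq_ι_of_primitive ?_
  rw [m.coderivation, deconcat_ι]
  simp [m.map_one]

theorem m₁_m₁ (o : H) : m.m₁ (m.m₁ o) = 0 := by
  have h := m.square_zero (TensorAlgebra.ι K o)
  rw [m.d_ι, m.d_ι] at h
  simpa using h

/-- The cohomology `ker m₁ / im m₁` of the complex `(H, m₁)`. -/
abbrev Cohomology : Type u :=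
  ↥(LinearMap.ker m.m₁) ⧸ (LinearMap.range m.m₁).submoduleOf (LinearMap.ker m.m₁)

/-- Minimal: `m₁ = 0`. -/
def IsMinimal : Prop := m.m₁ = 0

/-- Linear contractible: `m_k = 0` for `k ≥ 2` and `m₁` has trivial cohomology. -/
def IsLinearContractible : Prop :=
  (∀ k : ℕ, 2 ≤ k → m.op k = 0) ∧ Subsingleton m.Cohomology

/-- `D` is the direct sum of the `A_∞`-algebras `m` and `n`: its underlying graded vector space is
`V ⊕ C` and `D_k((v₁, c₁), …, (v_k, c_k)) = (m_k(v₁, …, v_k), n_k(c₁, …, c_k))`. -/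
def IsDirectSum {V : Type v} [AddCommGroup V] [Module K V] {C : Type v'} [AddCommGroup C]
    [Module K C] {𝒱 : ℤ → Submodule K V} {𝒞 : ℤ → Submodule K C}
    [DirectSum.Decomposition 𝒱] [DirectSum.Decomposition 𝒞]
    (D : AInfStructure (prodGrading 𝒱 𝒞)) (m : AInfStructure 𝒱) (n : AInfStructure 𝒞) : Prop :=
  ∀ (k : ℕ) (x : Fin k → V × C),
    D.op k x = (m.op k fun i => (x i).1, n.op k fun i => (x i).2)

end AInfStructure

end Algebras

/-! ### `A_∞`-morphisms -/

section Morphisms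

variable {K : Type w} [Field K]
variable {H : Type u} [AddCommGroup H] [Module K H] {ℋ : ℤ → Submodule K H}
  [DirectSum.Decomposition ℋ]
variable {V : Type v} [AddCommGroup V] [Module K V] {𝒱 : ℤ → Submodule K V}
  [DirectSum.Decomposition 𝒱]
variable {W : Type v'} [AddCommGroup W] [Module K W] {𝒲 : ℤ → Submodule K W}
  [DirectSum.Decomposition 𝒲]

/-- An `A_∞`-morphism `(V, m) → (H, n)`: a cohomomorphism `C(V) → C(H)` of degree zero that
intertwines the codifferentials and has `f₀ = 0` (equivalently, sends `1` to `1`). -/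
@[ext]
structure AInfHom (m : AInfStructure 𝒱) (n : AInfStructure ℋ) where
  toFun : Words K V →ₗ[K] Words K H
  degree_zero : ∀ (p : ℤ) (x : Words K V), x ∈ wordGrading 𝒱 p → toFun x ∈ wordGrading ℋ p
  comul : ∀ x : Words K V,
    deconcat K H (toFun x) = TensorProduct.map toFun toFun (deconcat K V x)
  map_one : toFun 1 = 1
  comm : ∀ x : Words K V, toFun (m.d x) = n.d (toFun x)

namespace AInfHom

/-- The identity `A_∞`-morphism. -/
def id (m : AInfStructure 𝒱) : AInfHom m m where
  toFun := LinearMap.id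
  degree_zero _ _ h := h
  comul x := by simp
  map_one := rfl
  comm _ := rfl

variable {m : AInfStructure 𝒱} {n : AInfStructure ℋ} {q : AInfStructure 𝒲}

/-- Composition `G ∘ F` of `A_∞`-morphisms. -/
def comp (G : AInfHom n q) (F : AInfHom m n) : AInfHom m q where
  toFun := G.toFun ∘ₗ F.toFun
  degree_zero p x h := G.degree_zero p _ (F.degree_zero p x h)
  comul x := by
    rw [TensorProduct.map_comp, LinearMap.comp_apply, LinearMap.comp_apply, G.comul, F.comul]
  map_one := by rw [LinearMap.comp_apply, F.map_one, G.map_one]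
  comm x := by simp only [LinearMap.comp_apply, F.comm, G.comm]

variable (F : AInfHom m n)

/-- The linear part `f₁ : V → H`. -/
def f₁ : V →ₗ[K] H := TensorAlgebra.ιInv ∘ₗ F.toFun ∘ₗ TensorAlgebra.ι K

theorem toFun_ι (o : V) : F.toFun (TensorAlgebra.ι K o) = TensorAlgebra.ι K (F.f₁ o) := by
  refine eq_ι_of_primitive ?_
  rw [F.comul, deconcat_ι]
  simp [F.map_one]

theorem f₁_m₁ (o : V) : F.f₁ (m.m₁ o) = n.m₁ (F.f₁ o) := by
  have h := F.comm (TensorAlgebra.ι K o)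
  rw [m.d_ι, F.toFun_ι, F.toFun_ι, n.d_ι] at h
  simpa using h

/-- The linear map induced by `f₁` on cohomology. -/
def cohomologyMap : m.Cohomology →ₗ[K] n.Cohomology :=
  Submodule.mapQ _ _
    (F.f₁.restrict (p := LinearMap.ker m.m₁) (q := LinearMap.ker n.m₁) fun x hx => by
      rw [LinearMap.mem_ker] at hx ⊢
      rw [← F.f₁_m₁, hx, map_zero])
    (by
      rintro ⟨x, hx⟩ hx'
      obtain ⟨y, rfl⟩ := hx'
      exact ⟨F.f₁ y, (F.f₁_m₁ y).symm⟩)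

/-- `F` is an `A_∞`-quasi-isomorphism: `f₁` induces an isomorphism on cohomology. -/
def IsQuasiIso : Prop := Function.Bijective F.cohomologyMap

/-- `F` is an `A_∞`-isomorphism: `f₁` is an isomorphism. -/
def IsIso : Prop := Function.Bijective F.f₁

/-- `G` is an inverse `A_∞`-quasi-isomorphism of `F`: a quasi-isomorphism in the opposite direction
inducing the inverse map on cohomology. -/
def IsInverseQuasiIso (G : AInfHom n m) (F : AInfHom m n) : Prop :=
  G.IsQuasiIso ∧ G.cohomologyMap ∘ₗ F.cohomologyMap = LinearMap.id ∧
    F.cohomologyMap ∘ₗ G.cohomologyMap = LinearMap.id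

/-- `I` is the inclusion of the summand `V` of `V ⊕ W`, with zero higher components. -/
def IsInclusion {D : AInfStructure (prodGrading 𝒱 𝒲)} (I : AInfHom m D) : Prop :=
  I.toFun = (TensorAlgebra.lift K (TensorAlgebra.ι K ∘ₗ LinearMap.inl K V W)).toLinearMap

end AInfHom

end Morphisms

end AInf

end

/-! Write `π` for the projection of words onto letters and `ε` for the counit. The linear part `i`
of a minimal model embeds `V` as a complement of the coboundaries among the cocycles, so the complex
`(H, m₁)` contracts onto `V` by maps `q`, `h` with `q i = 1`, `m₁ h + h m₁ = 1 - i q` and the side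
conditions (`AInfHom.exists_contraction`). A cohomomorphism amounts to a free choice of components
vanishing on the empty word (`exists_cohom`), and it is invertible as soon as its linear part is
(`IsCohom.exists_wordsIso`). Hence `A_∞`-structures can be transported along changes of coordinates,
and in suitable coordinates the model is the strict inclusion `i_*`
(`AInfHom.exists_straightening`).

The engine is recursion on word length, expressed in the convolution algebra of linear maps out of
`C(V)`. A cohomomorphism with components `f` solves `G = ε + (ι f) * G`, and the failure of `G` to
commute with codifferentials solves a similar equation. Convolution on the left with a map that
kills the empty word only uses values on proper suffixes, so such equations have unique solutions.

The heart is a strict left inverse `G` of `i_*`. Split the codifferential as `D = b + D''`, where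
`b` extends `m₁` and `D''` shortens words, and lift `h` to words by the tensor trick: `b ĥ + ĥ b = 1
- i_* q_*`. If `G` has components `g` and is to satisfy `G D = p G`, `G i_* = 1` and `g ĥ = 0`, then
applying `g` to this identity forces `g = q π + (π p G - g D'') ĥ`. As `p` has no linear part, the
last term only involves `g` on shorter words, so the equation is solvable
(`Contraction.exists_components`). That its solution does commute with the codifferentials is an
induction on length for the defect `E = G D - p G`, using `E D = -p E`
(`AInfHom.exists_retraction_of_strict`).

All three claims follow from `G`. It is inverse to the model on cohomology. Composing one minimal
model with the retraction of another gives a quasi-isomorphism of minimal algebras, whose linear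
part is therefore bijective. For the factorization, `ker q` is a contractible complex, and `γ = m₁ h
π + h π D` satisfies `γ D = m₁ γ`; so `γ` gives the components of a morphism to this linear algebra,
and `(G, γ)` identifies `D` with `p ⊕ ker q` and `i_*` with the inclusion
(`AInfHom.exists_factorization_of_strict`). -/

namespace AInf

/-! ### Words, the filtration by length, and recursion on length -/

section WordLists

variable (K : Type w) [Field K] {H : Type u} [AddCommGroup H] [Module K H]

/-- The word `o₁ ⋯ oₙ` of a list of letters. -/
noncomputable def word (l : List H) : Words K H := (l.map (TensorAlgebra.ι K)).prod

@[simp]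
theorem word_nil : word K ([] : List H) = 1 := rfl

@[simp]
theorem word_cons (o : H) (l : List H) : word K (o :: l) = TensorAlgebra.ι K o * word K l := by
  simp [word]

theorem word_ofFn {n : ℕ} (o : Fin n → H) :
    word K (List.ofFn o) = TensorAlgebra.tprod K H n o := by
  rw [word, TensorAlgebra.tprod_apply, List.map_ofFn]
  rfl

theorem word_eq_tprod (l : List H) : word K l = TensorAlgebra.tprod K H l.length l.get := by
  rw [← word_ofFn, List.ofFn_get]

theorem deconcat_word (l : List H) :
    deconcat K H (word K l) = ∑ k ∈ Finset.range (l.length + 1),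
      word K (l.take k) ⊗ₜ[K] word K (l.drop k) :=
  deconcat_list l

theorem span_word : Submodule.span K (Set.range (word K : List H → Words K H)) = ⊤ := by
  refine Submodule.eq_top_iff'.2 fun x => ?_
  induction x using words_induction with
  | one => exact Submodule.subset_span ⟨[], rfl⟩
  | cons o x hx =>
    have : Submodule.span K (Set.range (word K : List H → Words K H)) ≤
        (Submodule.span K (Set.range (word K : List H → Words K H))).comap
          (LinearMap.mulLeft K (TensorAlgebra.ι K o)) := by
      rw [Submodule.span_le]
      rintro _ ⟨l, rfl⟩
      exact Submodule.subset_span ⟨o :: l, by simp⟩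
    exact this hx
  | add x y hx hy => exact add_mem hx hy
  | smul r x hx => exact Submodule.smul_mem _ r hx

variable {K}

theorem linearMap_ext_word {M : Type*} [AddCommGroup M] [Module K M] {f g : Words K H →ₗ[K] M}
    (h : ∀ l, f (word K l) = g (word K l)) : f = g :=
  LinearMap.ext_on (span_word K) (by rintro _ ⟨l, rfl⟩; exact h l)

theorem algebraMapInv_ι_mul (o : H) (x : Words K H) :
    TensorAlgebra.algebraMapInv (TensorAlgebra.ι K o * x) = 0 := by
  simp [TensorAlgebra.algebraMapInv]

variable (K H)

/-- The span of the words of length less than `n`. -/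
def wordsBelow (n : ℕ) : Submodule K (Words K H) :=
  Submodule.span K {x | ∃ l : List H, l.length < n ∧ x = word K l}

variable {K H}

theorem word_mem_wordsBelow {l : List H} {n : ℕ} (h : l.length < n) :
    word K l ∈ wordsBelow K H n :=
  Submodule.subset_span ⟨l, h, rfl⟩

theorem wordsBelow_le {n : ℕ} {N : Submodule K (Words K H)}
    (h : ∀ l : List H, l.length < n → word K l ∈ N) : wordsBelow K H n ≤ N :=
  Submodule.span_le.2 (by rintro _ ⟨l, hl, rfl⟩; exact h l hl)

theorem wordsBelow_mono {n k : ℕ} (h : n ≤ k) : wordsBelow K H n ≤ wordsBelow K H k :=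
  wordsBelow_le fun _ hl => word_mem_wordsBelow (hl.trans_le h)

theorem wordsBelow_zero : wordsBelow K H 0 = ⊥ :=
  eq_bot_iff.2 (wordsBelow_le fun _ hl => absurd hl (Nat.not_lt_zero _))

theorem ι_mul_mem_wordsBelow (o : H) {x : Words K H} {n : ℕ} (hx : x ∈ wordsBelow K H n) :
    TensorAlgebra.ι K o * x ∈ wordsBelow K H (n + 1) := by
  have : wordsBelow K H n ≤ (wordsBelow K H (n + 1)).comap
      (LinearMap.mulLeft K (TensorAlgebra.ι K o)) :=
    wordsBelow_le fun l hl => by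
      simpa using word_mem_wordsBelow (K := K) (l := o :: l) (n := n + 1) (by simpa using hl)
  exact this hx

theorem exists_mem_wordsBelow (x : Words K H) : ∃ n, x ∈ wordsBelow K H n := by
  have hx : x ∈ Submodule.span K (Set.range (word K : List H → Words K H)) := by
    rw [span_word]; trivial
  induction hx using Submodule.span_induction with
  | mem x hx =>
    obtain ⟨l, rfl⟩ := hx
    exact ⟨_, word_mem_wordsBelow (Nat.lt_succ_self _)⟩
  | zero => exact ⟨0, zero_mem _⟩
  | add x y _ _ hx hy =>
    obtain ⟨n, hn⟩ := hx
    obtain ⟨k, hk⟩ := hy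
    exact ⟨max n k, add_mem (wordsBelow_mono (le_max_left _ _) hn)
      (wordsBelow_mono (le_max_right _ _) hk)⟩
  | smul r x _ hx =>
    obtain ⟨n, hn⟩ := hx
    exact ⟨n, Submodule.smul_mem _ r hn⟩

/-- Two linear maps agreeing on short words agree on their span. -/
theorem eq_on_wordsBelow {M : Type*} [AddCommGroup M] [Module K M] {f g : Words K H →ₗ[K] M}
    {n : ℕ} (h : ∀ l : List H, l.length < n → f (word K l) = g (word K l)) :
    ∀ x ∈ wordsBelow K H n, f x = g x :=
  fun _ hx => wordsBelow_le (N := LinearMap.eqLocus f g) h hx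

/-- The tensor algebra is the direct sum of the tensor powers, so a linear map may be prescribed
separately in each length. This glues the successive approximations of a recursion. -/
theorem exists_linearMap_word {M : Type*} [AddCommGroup M] [Module K M]
    (G : ℕ → Words K H →ₗ[K] M) :
    ∃ f : Words K H →ₗ[K] M, ∀ l : List H, f (word K l) = G l.length (word K l) := by
  refine ⟨DirectSum.toModule K ℕ M (fun n => G n ∘ₗ TensorPower.toTensorAlgebra) ∘ₗ
    (TensorAlgebra.toDirectSum : Words K H →ₐ[K] _).toLinearMap, fun l => ?_⟩
  rw [word_eq_tprod]
  simp only [LinearMap.comp_apply, AlgHom.toLinearMap_apply,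
    TensorAlgebra.toDirectSum_tensorPower_tprod]
  rw [← DirectSum.lof_eq_of K, DirectSum.toModule_lof]
  simp

/-- A contractive operator on linear maps out of `C(H)` has a fixed point, which locally inherits
any property that is preserved by the operator. -/
theorem exists_fixedPoint {M : Type*} [AddCommGroup M] [Module K M]
    (T : (Words K H →ₗ[K] M) → (Words K H →ₗ[K] M))
    (hT : ∀ n f g, (∀ x ∈ wordsBelow K H n, f x = g x) →
      ∀ x ∈ wordsBelow K H (n + 1), T f x = T g x)
    (Q : (Words K H →ₗ[K] M) → Prop) (Q_zero : Q 0) (Q_step : ∀ f, Q f → Q (T f)) :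
    ∃ f, T f = f ∧ ∀ n, ∃ g, Q g ∧ ∀ x ∈ wordsBelow K H n, f x = g x := by
  let s : ℕ → Words K H →ₗ[K] M := fun n => T^[n] 0
  have s_succ : ∀ n, s (n + 1) = T (s n) := fun n => Function.iterate_succ_apply' T n 0
  have step : ∀ n, ∀ x ∈ wordsBelow K H n, s n x = s (n + 1) x := by
    intro n
    induction n with
    | zero =>
      intro x hx
      rw [wordsBelow_zero, Submodule.mem_bot] at hx
      simp [hx]
    | succ n ih =>
      intro x hx
      rw [s_succ (n + 1), s_succ n]
      exact hT n _ _ (by rw [← s_succ n]; exact ih) x hx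
  have stable : ∀ n k, ∀ x ∈ wordsBelow K H n, s n x = s (n + k) x := by
    intro n k
    induction k with
    | zero => intro x _; rfl
    | succ k ih =>
      intro x hx
      rw [ih x hx, ← add_assoc]
      exact step _ x (wordsBelow_mono (Nat.le_add_right n k) hx)
  -- A word of length `n` lies in `wordsBelow K H (n + 1)`, where the iterates are stable from index
  -- `n + 1` on.
  obtain ⟨f, hf⟩ := exists_linearMap_word fun n => s (n + 1)
  have agree : ∀ n, ∀ x ∈ wordsBelow K H n, f x = s n x := by
    intro n
    refine eq_on_wordsBelow fun l hl => ?_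
    rw [hf]
    obtain ⟨k, rfl⟩ := Nat.exists_eq_add_of_lt hl
    have := stable (l.length + 1) k _ (word_mem_wordsBelow (Nat.lt_succ_self _))
    rw [this]
    congr 2
    omega
  refine ⟨f, linearMap_ext_word fun l => ?_, fun n => ⟨s n, ?_, agree n⟩⟩
  · rw [hT l.length f (s l.length) (agree _) _ (word_mem_wordsBelow (Nat.lt_succ_self _)),
      ← s_succ, hf]
  · induction n with
    | zero => exact Q_zero
    | succ n ih => rw [s_succ]; exact Q_step _ ih

end WordLists

/-! ### Degrees of words and signs -/

section Grading

variable {K : Type w} [Field K] {H : Type u} [AddCommGroup H] [Module K H]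
  {ℋ : ℤ → Submodule K H}

theorem word_mem_wordGrading {l : List H} {e : List ℤ}
    (h : List.Forall₂ (fun o k => o ∈ ℋ k) l e) : word K l ∈ wordGrading ℋ e.sum := by
  have hl : l.length = e.length := h.length_eq
  refine Submodule.subset_span ⟨l.length, fun i => e.get (i.cast hl), l.get, fun i => ?_, ?_,
    word_eq_tprod K l⟩
  · exact List.Forall₂.get h i.2 (hl ▸ i.2)
  · rw [← List.sum_ofFn]
    congr 1
    refine List.ext_get (by simp [hl]) fun n h1 h2 => by simp

theorem wordGrading_le {d : ℤ} {N : Submodule K (Words K H)}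
    (h : ∀ (l : List H) (e : List ℤ), List.Forall₂ (fun o k => o ∈ ℋ k) l e → e.sum = d →
      word K l ∈ N) : wordGrading ℋ d ≤ N := by
  refine Submodule.span_le.2 ?_
  rintro _ ⟨n, e, o, ho, rfl, rfl⟩
  rw [← word_ofFn]
  refine h _ (List.ofFn e) ?_ (List.sum_ofFn)
  rw [List.forall₂_iff_get]
  exact ⟨by simp, fun i h1 h2 => by simpa using ho _⟩

theorem one_mem_wordGrading : (1 : Words K H) ∈ wordGrading ℋ 0 :=
  word_mem_wordGrading (l := []) (e := []) List.Forall₂.nil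

theorem mul_mem_wordGrading {a b : ℤ} {x y : Words K H} (hx : x ∈ wordGrading ℋ a)
    (hy : y ∈ wordGrading ℋ b) : x * y ∈ wordGrading ℋ (a + b) := by
  have h1 : wordGrading ℋ a ≤ (wordGrading ℋ (a + b)).comap (LinearMap.mulRight K y) := by
    refine wordGrading_le fun l e hl he => ?_
    have h2 : wordGrading ℋ b ≤ (wordGrading ℋ (a + b)).comap
        (LinearMap.mulLeft K (word K l)) := by
      refine wordGrading_le fun l' e' hl' he' => ?_
      have := word_mem_wordGrading (K := K) (List.rel_append hl hl')
      rw [List.sum_append, he, he'] at this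
      simpa [word] using this
    exact h2 hy
  exact h1 hx

theorem ι_mem_wordGrading {a : ℤ} {o : H} (ho : o ∈ ℋ a) :
    TensorAlgebra.ι K o ∈ wordGrading ℋ a := by
  simpa using word_mem_wordGrading (K := K) (List.Forall₂.cons ho List.Forall₂.nil)

theorem wordGrading_induction {P : ℤ → Words K H → Prop} (one : P 0 1)
    (cons : ∀ a b o x, o ∈ ℋ a → x ∈ wordGrading ℋ b → P b x →
      P (a + b) (TensorAlgebra.ι K o * x))
    (add : ∀ d x y, P d x → P d y → P d (x + y)) (smul : ∀ d (r : K) x, P d x → P d (r • x))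
    {d : ℤ} {x : Words K H} (hx : x ∈ wordGrading ℋ d) : P d x := by
  have key : ∀ (l : List H) (e : List ℤ), List.Forall₂ (fun o k => o ∈ ℋ k) l e →
      P e.sum (word K l) := by
    intro l e h
    induction h with
    | nil => exact one
    | cons ho hl ih =>
      rw [word_cons, List.sum_cons]
      exact cons _ _ _ _ ho (word_mem_wordGrading hl) ih
  have zero : P d 0 := by
    have := Submodule.zero_mem (wordGrading ℋ d)
    by_cases hd : ∃ l e, List.Forall₂ (fun o k => o ∈ ℋ k) l e ∧ e.sum = d
    · obtain ⟨l, e, h, rfl⟩ := hd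
      simpa using smul _ (0 : K) _ (key l e h)
    -- The letter `0` is homogeneous of every degree, so there is always a word of degree `d`.
    · exfalso
      exact hd ⟨[0], [d], List.Forall₂.cons (zero_mem _) List.Forall₂.nil, by simp⟩
  let N : Submodule K (Words K H) :=
    { carrier := {x | P d x}
      add_mem' := fun hx hy => add d _ _ hx hy
      zero_mem' := zero
      smul_mem' := fun r x hx => smul d r x hx }
  exact wordGrading_le (N := N) (fun l e h he => by subst he; exact key l e h) hx

theorem ιInv_mem {d : ℤ} {x : Words K H} (hx : x ∈ wordGrading ℋ d) :
    TensorAlgebra.ιInv x ∈ ℋ d := by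
  -- Since `ιInv (o x) = ε(x) o`, the degree is right only because `ε` vanishes in nonzero degrees;
  -- that fact has to be carried through the induction.
  refine wordGrading_induction (P := fun d x => TensorAlgebra.ιInv x ∈ ℋ d ∧
    (d ≠ 0 → TensorAlgebra.algebraMapInv x = 0)) ?_ ?_ ?_ ?_ hx |>.1
  · rw [ιInv_one]; exact ⟨zero_mem _, fun h => absurd rfl h⟩
  · intro a b o x ho _ ih
    refine ⟨?_, fun _ => algebraMapInv_ι_mul o x⟩
    rw [ιInv_ι_mul]
    by_cases hb : b = 0
    · subst hb
      rw [add_zero]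
      exact Submodule.smul_mem _ _ ho
    · rw [ih.2 hb, zero_smul]; exact zero_mem _
  · intro d x y hx hy
    exact ⟨by rw [map_add]; exact add_mem hx.1 hy.1,
      fun h => by rw [map_add, hx.2 h, hy.2 h, add_zero]⟩
  · intro d r x hx
    exact ⟨by rw [map_smul]; exact Submodule.smul_mem _ _ hx.1,
      fun h => by rw [map_smul, hx.2 h, smul_zero]⟩

theorem algebraMapInv_of_mem {d : ℤ} (hd : d ≠ 0) {x : Words K H} (hx : x ∈ wordGrading ℋ d) :
    TensorAlgebra.algebraMapInv x = 0 := by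
  refine wordGrading_induction (P := fun d x => d ≠ 0 → TensorAlgebra.algebraMapInv x = 0)
    ?_ ?_ ?_ ?_ hx hd
  · exact fun h => absurd rfl h
  · exact fun a b o x _ _ _ _ => algebraMapInv_ι_mul o x
  · intro d x y hx hy h
    rw [map_add, hx h, hy h, add_zero]
  · intro d r x hx h
    rw [map_smul, hx h, smul_zero]

variable [DirectSum.Decomposition ℋ]

theorem mem_iSup_grading (x : H) : x ∈ ⨆ k, ℋ k := by
  rw [(DirectSum.Decomposition.isInternal ℋ).submodule_iSup_eq_top]
  trivial

variable (ℋ) in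
theorem linearMap_ext_grading {M : Type*} [AddCommGroup M] [Module K M] {f g : H →ₗ[K] M}
    (h : ∀ k, ∀ x ∈ ℋ k, f x = g x) : f = g := by
  refine LinearMap.ext fun x => ?_
  have : (⨆ k, ℋ k) ≤ LinearMap.eqLocus f g := iSup_le h
  exact this (mem_iSup_grading x)

variable (ℋ) in
theorem linearMap_ext_wordGrading {M : Type*} [AddCommGroup M] [Module K M]
    {f g : Words K H →ₗ[K] M} (h : ∀ d, ∀ x ∈ wordGrading ℋ d, f x = g x) : f = g := by
  have top : (⨆ d, wordGrading ℋ d) = ⊤ := by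
    refine Submodule.eq_top_iff'.2 fun x => ?_
    induction x using words_induction with
    | one => exact Submodule.mem_iSup_of_mem 0 one_mem_wordGrading
    | cons o x hx =>
      have h1 : (⨆ k, ℋ k) ≤ (⨆ d, wordGrading ℋ d).comap
          (LinearMap.mulRight K x ∘ₗ TensorAlgebra.ι K) := by
        refine iSup_le fun k y hy => ?_
        have h2 : (⨆ d, wordGrading ℋ d) ≤ (⨆ d, wordGrading ℋ d).comap
            (LinearMap.mulLeft K (TensorAlgebra.ι K y)) :=
          iSup_le fun d z hz =>
            Submodule.mem_iSup_of_mem (k + d) (mul_mem_wordGrading (ι_mem_wordGrading hy) hz)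
        exact h2 hx
      exact h1 (mem_iSup_grading o)
    | add x y hx hy => exact add_mem hx hy
    | smul r x hx => exact Submodule.smul_mem _ r hx
  refine LinearMap.ext fun x => ?_
  have : (⨆ d, wordGrading ℋ d) ≤ LinearMap.eqLocus f g := iSup_le h
  exact this (top ▸ Submodule.mem_top)

@[simp]
theorem wordSign_ι_mul (o : H) (x : Words K H) :
    wordSign ℋ (TensorAlgebra.ι K o * x) = TensorAlgebra.ι K (signMap ℋ o) * wordSign ℋ x := by
  simp [wordSign]

theorem wordSign_of_mem {d : ℤ} {x : Words K H} (hx : x ∈ wordGrading ℋ d) :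
    wordSign ℋ x = ((d.negOnePow : ℤˣ) : ℤ) • x := by
  refine wordGrading_induction (P := fun d x => wordSign ℋ x = ((d.negOnePow : ℤˣ) : ℤ) • x)
    ?_ ?_ ?_ ?_ hx
  · simp
  · intro a b o x ho _ ih
    rw [wordSign_ι_mul, ih, signMap_of_mem ℋ ho, Int.negOnePow_add, map_zsmul, Units.val_mul,
      smul_mul_smul_comm]
  · intro d x y hx hy
    rw [map_add, hx, hy, smul_add]
  · intro d r x hx
    rw [map_smul, hx, smul_comm]

theorem signMap_signMap (x : H) : signMap ℋ (signMap ℋ x) = x := by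
  have : signMap ℋ ∘ₗ signMap ℋ = LinearMap.id := by
    refine linearMap_ext_grading ℋ fun k x hx => ?_
    rw [LinearMap.comp_apply, signMap_of_mem ℋ hx, map_zsmul, signMap_of_mem ℋ hx, smul_smul,
      LinearMap.id_apply, ← Units.val_mul, Int.units_mul_self, Units.val_one, one_smul]
  exact LinearMap.congr_fun this x

theorem signMap_mem {k : ℤ} {x : H} (hx : x ∈ ℋ k) : signMap ℋ x ∈ ℋ k := by
  rw [signMap_of_mem ℋ hx]
  exact zsmul_mem hx _

variable {V : Type v} [AddCommGroup V] [Module K V] {𝒱 : ℤ → Submodule K V}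
  [DirectSum.Decomposition 𝒱]

theorem signMap_comm {f : V →ₗ[K] H} (hf : ∀ k, ∀ x ∈ 𝒱 k, f x ∈ ℋ k) (x : V) :
    f (signMap 𝒱 x) = signMap ℋ (f x) := by
  have : f ∘ₗ signMap 𝒱 = signMap ℋ ∘ₗ f := by
    refine linearMap_ext_grading 𝒱 fun k x hx => ?_
    simp only [LinearMap.comp_apply]
    rw [signMap_of_mem 𝒱 hx, map_zsmul, signMap_of_mem ℋ (hf k x hx)]
  exact LinearMap.congr_fun this x

theorem signMap_anticomm {f : V →ₗ[K] H} {d : ℤ} (hd : Odd d)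
    (hf : ∀ k, ∀ x ∈ 𝒱 k, f x ∈ ℋ (k + d)) (x : V) :
    f (signMap 𝒱 x) = - signMap ℋ (f x) := by
  have : f ∘ₗ signMap 𝒱 = - signMap ℋ ∘ₗ f := by
    refine linearMap_ext_grading 𝒱 fun k x hx => ?_
    simp only [LinearMap.comp_apply, LinearMap.neg_apply]
    rw [signMap_of_mem 𝒱 hx, map_zsmul, signMap_of_mem ℋ (hf k x hx), Int.negOnePow_add,
      Int.negOnePow_odd d hd]
    simp
  exact LinearMap.congr_fun this x

theorem wordSign_comm {f : Words K V →ₗ[K] Words K H}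
    (hf : ∀ d, ∀ x ∈ wordGrading 𝒱 d, f x ∈ wordGrading ℋ d) (x : Words K V) :
    f (wordSign 𝒱 x) = wordSign ℋ (f x) := by
  have : f ∘ₗ (wordSign 𝒱).toLinearMap = (wordSign ℋ).toLinearMap ∘ₗ f := by
    refine linearMap_ext_wordGrading 𝒱 fun k x hx => ?_
    simp only [LinearMap.comp_apply, AlgHom.toLinearMap_apply]
    rw [wordSign_of_mem hx, map_zsmul, wordSign_of_mem (hf k x hx)]
  exact LinearMap.congr_fun this x

end Grading

/-! ### The convolution algebra of maps out of the tensor coalgebra -/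

section Convolution

variable {K : Type w} [Field K] {V : Type v} [AddCommGroup V] [Module K V]
  {H : Type u} [AddCommGroup H] [Module K H]
  {A : Type*} [Ring A] [Algebra K A] {B : Type*} [Ring B] [Algebra K B]

/-- The convolution product of linear maps from `C(V)` to an algebra. -/
noncomputable def conv (a b : Words K V →ₗ[K] A) : Words K V →ₗ[K] A :=
  LinearMap.mul' K A ∘ₗ TensorProduct.map a b ∘ₗ deconcat K V

theorem conv_apply (a b : Words K V →ₗ[K] A) (x : Words K V) :
    conv a b x = LinearMap.mul' K A (TensorProduct.map a b (deconcat K V x)) := rfl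

theorem conv_word (a b : Words K V →ₗ[K] A) (l : List V) :
    conv a b (word K l) =
      ∑ k ∈ Finset.range (l.length + 1), a (word K (l.take k)) * b (word K (l.drop k)) := by
  rw [conv_apply, deconcat_word, map_sum, map_sum]
  simp

@[simp]
theorem conv_one (a b : Words K V →ₗ[K] A) : conv a b 1 = a 1 * b 1 := by
  simp [conv_apply]

theorem conv_ι_mul (a b : Words K V →ₗ[K] A) (o : V) (x : Words K V) :
    conv a b (TensorAlgebra.ι K o * x) = a 1 * b (TensorAlgebra.ι K o * x) +
      conv (a ∘ₗ LinearMap.mulLeft K (TensorAlgebra.ι K o)) b x := by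
  rw [conv_apply, deconcat_ι_mul, map_add, map_add, TensorProduct.map_tmul,
    LinearMap.mul'_apply, ← LinearMap.comp_apply (TensorProduct.map a b), LinearMap.map_comp_rTensor]
  rfl

theorem conv_add_left (a a' b : Words K V →ₗ[K] A) : conv (a + a') b = conv a b + conv a' b := by
  simp [conv, TensorProduct.map_add_left, LinearMap.comp_add, LinearMap.add_comp]

theorem conv_add_right (a b b' : Words K V →ₗ[K] A) : conv a (b + b') = conv a b + conv a b' := by
  simp [conv, TensorProduct.map_add_right, LinearMap.comp_add, LinearMap.add_comp]

theorem conv_sub_left (a a' b : Words K V →ₗ[K] A) : conv (a - a') b = conv a b - conv a' b := by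
  rw [eq_sub_iff_add_eq, ← conv_add_left, sub_add_cancel]

theorem conv_sub_right (a b b' : Words K V →ₗ[K] A) : conv a (b - b') = conv a b - conv a b' := by
  rw [eq_sub_iff_add_eq, ← conv_add_right, sub_add_cancel]

@[simp]
theorem conv_zero_left (b : Words K V →ₗ[K] A) : conv 0 b = 0 := by
  have := conv_sub_left 0 0 b
  simpa using this

theorem conv_mulLeft (c : A) (a b : Words K V →ₗ[K] A) (x : Words K V) :
    conv (LinearMap.mulLeft K c ∘ₗ a) b x = c * conv a b x := by
  rw [conv_apply, conv_apply]
  induction deconcat K V x using TensorProduct.induction_on with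
  | zero => simp
  | tmul y z => simp [mul_assoc]
  | add y z hy hz => simp only [map_add, hy, hz, mul_add]

/-- This is coassociativity of deconcatenation in dual form. The first letter of a word is absorbed
into the first factor, which is why the induction runs over all factors at once. -/
theorem conv_assoc (a b c : Words K V →ₗ[K] A) : conv (conv a b) c = conv a (conv b c) := by
  refine LinearMap.ext fun x => ?_
  induction x using words_induction generalizing a b c with
  | one => simp [mul_assoc]
  | cons o x ih =>
    rw [conv_ι_mul, conv_ι_mul a, conv_ι_mul b c, ← ih]
    have : conv a b ∘ₗ LinearMap.mulLeft K (TensorAlgebra.ι K o) =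
        LinearMap.mulLeft K (a 1) ∘ₗ (b ∘ₗ LinearMap.mulLeft K (TensorAlgebra.ι K o)) +
          conv (a ∘ₗ LinearMap.mulLeft K (TensorAlgebra.ι K o)) b := by
      refine LinearMap.ext fun y => ?_
      simp [conv_ι_mul]
    rw [this, conv_add_left, LinearMap.add_apply, conv_mulLeft, conv_one]
    simp only [mul_add, mul_assoc]
    abel
  | add x y hx hy => simp only [map_add, hx, hy]
  | smul r x hx => simp only [map_smul, hx]

theorem comp_conv (φ : A →ₐ[K] B) (a b : Words K V →ₗ[K] A) :
    φ.toLinearMap ∘ₗ conv a b = conv (φ.toLinearMap ∘ₗ a) (φ.toLinearMap ∘ₗ b) := by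
  refine LinearMap.ext fun x => ?_
  rw [LinearMap.comp_apply, conv_apply, conv_apply]
  induction deconcat K V x using TensorProduct.induction_on with
  | zero => simp
  | tmul y z => simp
  | add y z hy hz => simp only [map_add, hy, hz]

variable (K V A) in
/-- The unit `x ↦ ε(x) 1` of the convolution product. -/
noncomputable def augm : Words K V →ₗ[K] A :=
  Algebra.linearMap K A ∘ₗ (TensorAlgebra.algebraMapInv : Words K V →ₐ[K] K).toLinearMap

theorem augm_apply (x : Words K V) :
    augm K V A x = algebraMap K A (TensorAlgebra.algebraMapInv x) := rfl

@[simp]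
theorem augm_one : augm K V A 1 = 1 := by simp [augm_apply]

@[simp]
theorem augm_ι_mul (o : V) (x : Words K V) : augm K V A (TensorAlgebra.ι K o * x) = 0 := by
  rw [augm_apply, algebraMapInv_ι_mul, map_zero]

theorem comp_augm (φ : A →ₐ[K] B) : φ.toLinearMap ∘ₗ augm K V A = augm K V B :=
  LinearMap.ext fun x => by simp [augm_apply]

@[simp]
theorem augm_conv (b : Words K V →ₗ[K] A) : conv (augm K V A) b = b := by
  refine LinearMap.ext fun x => ?_
  induction x using words_induction with
  | one => simp
  | cons o x ih =>
    have : augm K V A ∘ₗ LinearMap.mulLeft K (TensorAlgebra.ι K o) = 0 :=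
      LinearMap.ext fun y => by simp
    rw [conv_ι_mul, this]
    simp
  | add x y hx hy => simp only [map_add, hx, hy]
  | smul r x hx => simp only [map_smul, hx]

/-- The empty prefix contributes nothing, so the right side evaluates `E` on proper suffixes only,
and induction on length applies. This is the source of uniqueness for the recursions below. -/
theorem eq_zero_of_eq_conv {a E : Words K V →ₗ[K] A} (ha : a 1 = 0) (hE : E = conv a E) :
    E = 0 := by
  refine linearMap_ext_word fun l => ?_
  induction h : l.length using Nat.strong_induction_on generalizing l with
  | _ n ih =>
    subst h
    rw [hE, conv_word]
    refine Finset.sum_eq_zero fun k hk => ?_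
    rcases Nat.eq_zero_or_pos k with rfl | hk0
    · simp [ha]
    · by_cases hl : l.length = 0
      · rw [List.length_eq_zero_iff] at hl
        simp [hl, ha]
      · rw [ih _ (by rw [List.length_drop]; omega) (l.drop k) rfl]
        simp

theorem eq_of_eq_add_conv {a E E' R : Words K V →ₗ[K] A} (ha : a 1 = 0)
    (hE : E = R + conv a E) (hE' : E' = R + conv a E') : E = E' := by
  refine sub_eq_zero.1 (eq_zero_of_eq_conv ha ?_)
  rw [conv_sub_right]
  nth_rw 1 [hE, hE']
  abel

/-- A linear map which is determined by its linear component `e` through a convolution recursion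
equals `e` on the shortest words on which `e` does not vanish. -/
theorem eq_ι_of_eq_conv {E a : Words K V →ₗ[K] Words K H} {e g : Words K V →ₗ[K] H}
    (hE : E = conv (TensorAlgebra.ι K ∘ₗ e) a + conv (TensorAlgebra.ι K ∘ₗ g) E)
    (ha : a 1 = 1) (hg : g 1 = 0) {n : ℕ} (he : ∀ x ∈ wordsBelow K V n, e x = 0) :
    ∀ x ∈ wordsBelow K V (n + 1), E x = TensorAlgebra.ι K (e x) := by
  suffices h : ∀ l : List V, l.length < n + 1 → E (word K l) = TensorAlgebra.ι K (e (word K l)) from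
    eq_on_wordsBelow (f := E) (g := TensorAlgebra.ι K ∘ₗ e) h
  intro l hl
  induction h : l.length using Nat.strong_induction_on generalizing l with
  | _ m ih =>
    subst h
    have h2 : conv (TensorAlgebra.ι K ∘ₗ g) E (word K l) = 0 := by
      rw [conv_word]
      refine Finset.sum_eq_zero fun k hk => ?_
      rcases Nat.eq_zero_or_pos k with rfl | hk0
      · simp [hg]
      · by_cases hl0 : l.length = 0
        · rw [List.length_eq_zero_iff] at hl0
          simp [hl0, hg]
        · have hlt : (l.drop k).length < l.length := by rw [List.length_drop]; omega
          rw [ih _ hlt (l.drop k) (by omega) rfl, he _ (word_mem_wordsBelow (by omega))]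
          simp
    rw [hE, LinearMap.add_apply, h2, add_zero, conv_word, Finset.sum_range_succ,
      Finset.sum_eq_zero]
    · simp [ha]
    · intro k hk
      rw [Finset.mem_range] at hk
      rw [LinearMap.comp_apply, he _ (word_mem_wordsBelow (by rw [List.length_take]; omega))]
      simp

theorem augm_add_conv (x : Words K V) :
    augm K V (Words K V) x + conv (TensorAlgebra.ι K ∘ₗ TensorAlgebra.ιInv) LinearMap.id x = x := by
  have h := concat_deconcat x
  rw [LinearMap.rTensor] at h
  rw [conv_apply, h, augm_apply]
  abel

/-- If `∑ ψ(x₁) G(x₂) = 0` where `G(1) = 1`, then `ψ = 0`. -/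
theorem eq_zero_of_conv_eq_zero {ψ : Words K V →ₗ[K] K} {G : Words K V →ₗ[K] Words K H}
    (hG : G 1 = 1) (h : conv (Algebra.linearMap K _ ∘ₗ ψ) G = 0) : ψ = 0 := by
  refine linearMap_ext_word fun l => ?_
  induction hl : l.length using Nat.strong_induction_on generalizing l with
  | _ m ih =>
    subst hl
    have := LinearMap.congr_fun h (word K l)
    rw [conv_word, Finset.sum_range_succ, Finset.sum_eq_zero] at this
    · simpa [hG] using this
    · intro k hk
      rw [Finset.mem_range] at hk
      rw [LinearMap.comp_apply, ih _ (by rw [List.length_take]; omega) (l.take k) rfl]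
      simp

/-- In this form comultiplicativity is an equation in the convolution algebra with values in `C(H) ⊗
C(H)`, where uniqueness of recursions can be applied. -/
theorem map_eq_conv (f g : Words K V →ₗ[K] Words K H) (x : Words K V) :
    TensorProduct.map f g (deconcat K V x) =
      conv ((Algebra.TensorProduct.includeLeft :
          Words K H →ₐ[K] Words K H ⊗[K] Words K H).toLinearMap ∘ₗ f)
        ((Algebra.TensorProduct.includeRight :
          Words K H →ₐ[K] Words K H ⊗[K] Words K H).toLinearMap ∘ₗ g) x := by
  rw [conv_apply]
  induction deconcat K V x using TensorProduct.induction_on with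
  | zero => simp
  | tmul y z => simp
  | add y z hy hz => simp only [map_add, hy, hz]

/-- Applying `p` to the first tensor factor of a coproduct and concatenating. -/
theorem concat_map (a b c : Words K V →ₗ[K] Words K H) (p : Words K H →ₗ[K] Words K H)
    (x : Words K V)
    (h : deconcat K H (c x) = TensorProduct.map a b (deconcat K V x)) :
    conv p LinearMap.id (c x) = conv (p ∘ₗ a) b x := by
  rw [conv_apply, h, conv_apply]
  induction deconcat K V x using TensorProduct.induction_on with
  | zero => simp
  | tmul y z => simp
  | add y z hy hz => simp only [map_add, hy, hz]

end Convolution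

/-! ### Cohomomorphisms and their components -/

section Cohom

variable {K : Type w} [Field K] {V : Type v} [AddCommGroup V] [Module K V]
  {H : Type u} [AddCommGroup H] [Module K H]
  {W : Type v'} [AddCommGroup W] [Module K W]

/-- Cohomomorphisms `C(V) → C(H)` with `f₀ = 0`. -/
structure IsCohom (G : Words K V →ₗ[K] Words K H) : Prop where
  comul : ∀ x, deconcat K H (G x) = TensorProduct.map G G (deconcat K V x)
  map_one : G 1 = 1

/-- Cohomomorphisms preserve the counit. -/
theorem IsCohom.algebraMapInv {G : Words K V →ₗ[K] Words K H} (hG : IsCohom G) (x : Words K V) :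
    TensorAlgebra.algebraMapInv (G x) = TensorAlgebra.algebraMapInv x := by
  have key : (TensorAlgebra.algebraMapInv : Words K H →ₐ[K] K).toLinearMap ∘ₗ G -
      (TensorAlgebra.algebraMapInv : Words K V →ₐ[K] K).toLinearMap = 0 := by
    -- Applying `ε` to the left factor of the coproduct of `G x` gives `(ε G) * G = G = ε * G`, and
    -- `G` can be cancelled on the right.
    refine eq_zero_of_conv_eq_zero hG.map_one ?_
    rw [LinearMap.comp_sub, conv_sub_left, sub_eq_zero]
    change _ = conv (augm K V (Words K H)) G
    rw [augm_conv]
    refine LinearMap.ext fun x => ?_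
    have := concat_map G G G (augm K H (Words K H)) x (hG.comul x)
    rw [augm_conv] at this
    exact this.symm
  exact sub_eq_zero.1 (LinearMap.congr_fun key x)

theorem IsCohom.comp {F : Words K H →ₗ[K] Words K W} {G : Words K V →ₗ[K] Words K H}
    (hF : IsCohom F) (hG : IsCohom G) : IsCohom (F ∘ₗ G) where
  comul x := by
    rw [TensorProduct.map_comp, LinearMap.comp_apply, LinearMap.comp_apply, hF.comul, hG.comul]
  map_one := by rw [LinearMap.comp_apply, hG.map_one, hF.map_one]

theorem IsCohom.id : IsCohom (LinearMap.id : Words K V →ₗ[K] Words K V) where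
  comul x := by simp
  map_one := rfl

/-- The first letter of `G x` is split off: by comultiplicativity it is a component of `G` on a
prefix, followed by `G` of the remaining suffix. Unrolled, this is the usual sum of products of
components over all partitions of a word into consecutive pieces. -/
theorem IsCohom.eq_add_conv {G : Words K V →ₗ[K] Words K H} (hG : IsCohom G) :
    G = augm K V _ + conv (TensorAlgebra.ι K ∘ₗ TensorAlgebra.ιInv ∘ₗ G) G := by
  refine LinearMap.ext fun x => ?_
  nth_rw 1 [← augm_add_conv (G x)]
  rw [concat_map G G G _ x (hG.comul x), augm_apply, hG.algebraMapInv]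
  rfl

theorem IsCohom.ιInv_one {G : Words K V →ₗ[K] Words K H} (hG : IsCohom G) :
    (TensorAlgebra.ιInv ∘ₗ G) 1 = 0 := by
  rw [LinearMap.comp_apply, hG.map_one, AInf.ιInv_one]

/-- Cohomomorphisms are determined by their components. -/
theorem IsCohom.ext {F G : Words K V →ₗ[K] Words K H} (hF : IsCohom F) (hG : IsCohom G)
    (h : TensorAlgebra.ιInv ∘ₗ F = TensorAlgebra.ιInv ∘ₗ G) : F = G := by
  refine eq_of_eq_add_conv (a := TensorAlgebra.ι K ∘ₗ TensorAlgebra.ιInv ∘ₗ F) ?_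
    hF.eq_add_conv ?_
  · rw [LinearMap.comp_apply, hF.ιInv_one, map_zero]
  · rw [h]; exact hG.eq_add_conv

theorem conv_mem_wordGrading {𝒱 : ℤ → Submodule K V} {ℋ : ℤ → Submodule K H}
    {a b : Words K V →ₗ[K] Words K H}
    (ha : ∀ p, ∀ x ∈ wordGrading 𝒱 p, a x ∈ wordGrading ℋ p)
    (hb : ∀ p, ∀ x ∈ wordGrading 𝒱 p, b x ∈ wordGrading ℋ p) :
    ∀ p, ∀ x ∈ wordGrading 𝒱 p, conv a b x ∈ wordGrading ℋ p := by
  intro p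
  change wordGrading 𝒱 p ≤ (wordGrading ℋ p).comap (conv a b)
  refine wordGrading_le fun l e hl he => ?_
  rw [Submodule.mem_comap, conv_word]
  refine Submodule.sum_mem _ fun k _ => ?_
  have h1 := word_mem_wordGrading (K := K) (List.forall₂_take k hl)
  have h2 := word_mem_wordGrading (K := K) (List.forall₂_drop k hl)
  have h3 := mul_mem_wordGrading (ha _ _ h1) (hb _ _ h2)
  rwa [← List.sum_append, List.take_append_drop, he] at h3

theorem augm_mem_wordGrading {𝒱 : ℤ → Submodule K V} {ℋ : ℤ → Submodule K H} :
    ∀ p, ∀ x ∈ wordGrading 𝒱 p, augm K V (Words K H) x ∈ wordGrading ℋ p := by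
  intro p x hx
  by_cases hp : p = 0
  · subst hp
    rw [augm_apply, Algebra.algebraMap_eq_smul_one]
    exact Submodule.smul_mem _ _ one_mem_wordGrading
  · rw [augm_apply, algebraMapInv_of_mem hp hx, map_zero]
    exact zero_mem _

/-- A solution of `G = ε + f * G` is a cohomomorphism with components `f`. -/
theorem isCohom_of_eq_add_conv {f : Words K V →ₗ[K] H} (hf : f 1 = 0)
    {G : Words K V →ₗ[K] Words K H} (hG : G = augm K V _ + conv (TensorAlgebra.ι K ∘ₗ f) G) :
    IsCohom G ∧ TensorAlgebra.ιInv ∘ₗ G = f := by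
  have one : G 1 = 1 := by
    rw [hG]
    simp [hf]
  refine ⟨⟨fun x => ?_, one⟩, ?_⟩
  · rw [map_eq_conv, ← LinearMap.comp_apply]
    refine LinearMap.congr_fun ?_ x
    set L := (Algebra.TensorProduct.includeLeft :
          Words K H →ₐ[K] Words K H ⊗[K] Words K H)
    set R := (Algebra.TensorProduct.includeRight :
          Words K H →ₐ[K] Words K H ⊗[K] Words K H)
    -- Both `Δ G` and `(L G) * (R G)` solve `X = R G + (L ι f) * X`: the former by the recursion for
    -- `Δ` on a first letter, the latter by convolving `L G = ε + (L ι f) * L G` with `R G`.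
    refine eq_of_eq_add_conv (a := L.toLinearMap ∘ₗ TensorAlgebra.ι K ∘ₗ f)
      (R := R.toLinearMap ∘ₗ G) (by simp [hf]) ?_ ?_
    · have h1 : deconcat K H ∘ₗ conv (TensorAlgebra.ι K ∘ₗ f) G =
          R.toLinearMap ∘ₗ conv (TensorAlgebra.ι K ∘ₗ f) G +
            conv (L.toLinearMap ∘ₗ TensorAlgebra.ι K ∘ₗ f) (deconcat K H ∘ₗ G) := by
        refine LinearMap.ext fun x => ?_
        simp only [LinearMap.comp_apply, LinearMap.add_apply, conv_apply]
        induction deconcat K V x using TensorProduct.induction_on with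
        | zero => simp
        | tmul y z =>
          simp only [TensorProduct.map_tmul, LinearMap.mul'_apply, LinearMap.comp_apply,
            deconcat_ι_mul, AlgHom.toLinearMap_apply]
          congr 1
          generalize deconcat K H (G z) = t
          induction t using TensorProduct.induction_on with
          | zero => simp
          | tmul y z => simp [L]
          | add y z hy hz => simp only [map_add, hy, hz, mul_add]
        | add y z hy hz => simp only [map_add, hy, hz]; abel
      have h2 : deconcat K H ∘ₗ augm K V _ = R.toLinearMap ∘ₗ augm K V _ := by
        refine LinearMap.ext fun x => ?_
        simp [augm_apply, Algebra.algebraMap_eq_smul_one, R]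
      nth_rw 1 [hG]
      rw [LinearMap.comp_add, h1, h2, ← add_assoc, ← LinearMap.comp_add, ← hG]
    · have h3 : L.toLinearMap ∘ₗ G = augm K V _ +
          conv (L.toLinearMap ∘ₗ TensorAlgebra.ι K ∘ₗ f) (L.toLinearMap ∘ₗ G) := by
        nth_rw 1 [hG]
        rw [LinearMap.comp_add, comp_augm, comp_conv]
      nth_rw 1 [h3]
      rw [conv_add_left, augm_conv, conv_assoc]
  · have h0 : (TensorAlgebra.algebraMapInv : Words K H →ₐ[K] K).toLinearMap ∘ₗ G =
        (TensorAlgebra.algebraMapInv : Words K V →ₐ[K] K).toLinearMap := by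
      have h4 : (TensorAlgebra.algebraMapInv : Words K H →ₐ[K] K).toLinearMap ∘ₗ
          TensorAlgebra.ι K ∘ₗ f = 0 :=
        LinearMap.ext fun y => by simp [TensorAlgebra.algebraMapInv]
      rw [hG, LinearMap.comp_add, comp_augm, comp_conv, h4, conv_zero_left, add_zero]
      rfl
    -- The letter component of `f(x₁) G(x₂)` is `ε(G x₂) f(x₁)`, and `ε G = ε`; only the split with
    -- empty suffix survives.
    refine linearMap_ext_word fun l => ?_
    have h5 : (TensorAlgebra.ιInv : Words K H →ₗ[K] H) (augm K V _ (word K l)) = 0 := by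
      rw [augm_apply, Algebra.algebraMap_eq_smul_one, map_smul, ιInv_one, smul_zero]
    rw [LinearMap.comp_apply, hG, LinearMap.add_apply, map_add, h5, zero_add, conv_word, map_sum,
      Finset.sum_range_succ, Finset.sum_eq_zero]
    · rw [LinearMap.comp_apply, ιInv_ι_mul]
      simp [one]
    · intro k hk
      rw [Finset.mem_range] at hk
      have h6 := LinearMap.congr_fun h0 (word K (l.drop k))
      simp only [LinearMap.comp_apply, AlgHom.toLinearMap_apply] at h6
      rw [LinearMap.comp_apply, ιInv_ι_mul, h6]
      obtain ⟨o, t, ht⟩ := List.exists_cons_of_length_pos (l := l.drop k)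
        (by rw [List.length_drop]; omega)
      rw [ht, word_cons, algebraMapInv_ι_mul, zero_smul]

/-- The equation `G = ε + (ι f) * G` is contractive when `f 1 = 0`. The condition on `f` and the
gradings stand inside the existential so that the chosen `G` depends on `f` alone. -/
theorem exists_cohom (f : Words K V →ₗ[K] H) : ∃ G : Words K V →ₗ[K] Words K H, f 1 = 0 →
    IsCohom G ∧ TensorAlgebra.ιInv ∘ₗ G = f ∧
      ∀ (𝒱 : ℤ → Submodule K V) (ℋ : ℤ → Submodule K H),
        (∀ p, ∀ x ∈ wordGrading 𝒱 p, f x ∈ ℋ p) →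
          ∀ p, ∀ x ∈ wordGrading 𝒱 p, G x ∈ wordGrading ℋ p := by
  by_cases hf : f 1 = 0
  swap
  · exact ⟨0, fun h => absurd h hf⟩
  obtain ⟨G, hG, hdeg⟩ := exists_fixedPoint
    (T := fun G => augm K V _ + conv (TensorAlgebra.ι K ∘ₗ f) G) (by
      intro n G G' h
      refine eq_on_wordsBelow fun l hl => ?_
      rw [LinearMap.add_apply, LinearMap.add_apply, conv_word, conv_word]
      congr 1
      refine Finset.sum_congr rfl fun k _ => ?_
      rcases Nat.eq_zero_or_pos k with rfl | hk0
      · simp [hf]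
      · rcases l with _ | ⟨o, t⟩
        · simp [hf]
        · rw [h _ (word_mem_wordsBelow (by simp at hl ⊢; omega))])
    (fun G => ∀ (𝒱 : ℤ → Submodule K V) (ℋ : ℤ → Submodule K H),
        (∀ p, ∀ x ∈ wordGrading 𝒱 p, f x ∈ ℋ p) →
          ∀ p, ∀ x ∈ wordGrading 𝒱 p, G x ∈ wordGrading ℋ p)
    (fun _ _ _ _ _ _ => zero_mem _)
    (fun G h 𝒱 ℋ hfd p x hx => add_mem (augm_mem_wordGrading p x hx)
      (conv_mem_wordGrading (a := TensorAlgebra.ι K ∘ₗ f) (b := G)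
        (fun p x hx => ι_mem_wordGrading (hfd p x hx)) (h 𝒱 ℋ hfd) p x hx))
  have h := isCohom_of_eq_add_conv hf hG.symm
  refine ⟨G, fun _ => ⟨h.1, h.2, fun 𝒱 ℋ hfd p => ?_⟩⟩
  change wordGrading 𝒱 p ≤ (wordGrading ℋ p).comap G
  refine wordGrading_le fun l e hl he => ?_
  obtain ⟨g, hg, hgG⟩ := hdeg (l.length + 1)
  rw [Submodule.mem_comap, hgG _ (word_mem_wordsBelow (Nat.lt_succ_self _))]
  exact hg 𝒱 ℋ hfd p _ (he ▸ word_mem_wordGrading hl)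

/-- The cohomomorphism `C(V) → C(H)` with given components `f`, where `f(1) = 0`. -/
noncomputable def cohomLift (f : Words K V →ₗ[K] H) : Words K V →ₗ[K] Words K H :=
  (exists_cohom f).choose

theorem isCohom_cohomLift {f : Words K V →ₗ[K] H} (hf : f 1 = 0) : IsCohom (cohomLift f) :=
  ((exists_cohom f).choose_spec hf).1

theorem ιInv_comp_cohomLift {f : Words K V →ₗ[K] H} (hf : f 1 = 0) :
    TensorAlgebra.ιInv ∘ₗ cohomLift f = f :=
  ((exists_cohom f).choose_spec hf).2.1

theorem cohomLift_mem {f : Words K V →ₗ[K] H} (hf : f 1 = 0) {𝒱 : ℤ → Submodule K V}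
    {ℋ : ℤ → Submodule K H} (h : ∀ p, ∀ x ∈ wordGrading 𝒱 p, f x ∈ ℋ p) :
    ∀ p, ∀ x ∈ wordGrading 𝒱 p, cohomLift f x ∈ wordGrading ℋ p :=
  ((exists_cohom f).choose_spec hf).2.2 𝒱 ℋ h

/-- Changing the components on words of length `n` changes the cohomomorphism on these words only
by the same amount. -/
theorem cohomLift_sub {f f' : Words K V →ₗ[K] H} (hf : f 1 = 0) (hf' : f' 1 = 0) {n : ℕ}
    (h : ∀ x ∈ wordsBelow K V n, f x = f' x) :
    ∀ x ∈ wordsBelow K V (n + 1),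
      cohomLift f x - cohomLift f' x = TensorAlgebra.ι K (f x - f' x) := by
  have h1 := (isCohom_cohomLift hf).eq_add_conv
  have h2 := (isCohom_cohomLift hf').eq_add_conv
  rw [ιInv_comp_cohomLift hf] at h1
  rw [ιInv_comp_cohomLift hf'] at h2
  refine eq_ι_of_eq_conv (E := cohomLift f - cohomLift f') (e := f - f') (a := cohomLift f)
    (g := f') ?_ (isCohom_cohomLift hf).map_one hf'
    (fun x hx => by rw [LinearMap.sub_apply, h x hx, sub_self])
  -- With `F`, `F'` the two lifts, `F - F' = ι(f - f') * F + (ι f') * (F - F')`.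
  rw [LinearMap.comp_sub, conv_sub_left, conv_sub_right]
  nth_rw 1 [h1, h2]
  abel

end Cohom

theorem tensorMap_map {K : Type*} [Field K] {A B C A' B' C' : Type*} [AddCommGroup A] [Module K A]
    [AddCommGroup B] [Module K B] [AddCommGroup C] [Module K C] [AddCommGroup A'] [Module K A']
    [AddCommGroup B'] [Module K B'] [AddCommGroup C'] [Module K C'] (f : B →ₗ[K] C)
    (f' : B' →ₗ[K] C') (g : A →ₗ[K] B) (g' : A' →ₗ[K] B') (t : A ⊗[K] A') :
    TensorProduct.map f f' (TensorProduct.map g g' t) =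
      TensorProduct.map (f ∘ₗ g) (f' ∘ₗ g') t := by
  rw [TensorProduct.map_comp, LinearMap.comp_apply]

/-! ### Strict cohomomorphisms as leading terms -/

section Strict

variable {K : Type w} [Field K] {V : Type v} [AddCommGroup V] [Module K V]
  {H : Type u} [AddCommGroup H] [Module K H]
  {W : Type v'} [AddCommGroup W] [Module K W]

/-- The cohomomorphism with linear component `g` and zero higher components. -/
noncomputable def strictMap (g : V →ₗ[K] H) : Words K V →ₗ[K] Words K H :=
  (TensorAlgebra.lift K (TensorAlgebra.ι K ∘ₗ g)).toLinearMap

@[simp]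
theorem strictMap_one (g : V →ₗ[K] H) : strictMap g 1 = 1 := by simp [strictMap]

@[simp]
theorem strictMap_ι_mul (g : V →ₗ[K] H) (o : V) (x : Words K V) :
    strictMap g (TensorAlgebra.ι K o * x) = TensorAlgebra.ι K (g o) * strictMap g x := by
  simp [strictMap]

@[simp]
theorem strictMap_ι (g : V →ₗ[K] H) (o : V) :
    strictMap g (TensorAlgebra.ι K o) = TensorAlgebra.ι K (g o) := by
  simp [strictMap]

theorem strictMap_word (g : V →ₗ[K] H) (l : List V) :
    strictMap g (word K l) = word K (l.map g) := by
  induction l with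
  | nil => simp
  | cons o t ih => simp [ih]

theorem strictMap_comp (g : H →ₗ[K] W) (f : V →ₗ[K] H) (x : Words K V) :
    strictMap g (strictMap f x) = strictMap (g ∘ₗ f) x := by
  have : strictMap g ∘ₗ strictMap f = strictMap (g ∘ₗ f) :=
    linearMap_ext_word fun l => by simp [strictMap_word]
  exact LinearMap.congr_fun this x

@[simp]
theorem strictMap_id (x : Words K V) : strictMap (LinearMap.id : V →ₗ[K] V) x = x := by
  have : strictMap (LinearMap.id : V →ₗ[K] V) = LinearMap.id :=
    linearMap_ext_word fun l => by simp [strictMap_word]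
  exact LinearMap.congr_fun this x

theorem isCohom_strictMap (g : V →ₗ[K] H) : IsCohom (strictMap g) where
  comul x := by
    induction x using words_induction with
    | one => simp
    | cons o x ih =>
      rw [strictMap_ι_mul, deconcat_ι_mul, deconcat_ι_mul, ih, map_add, TensorProduct.map_tmul,
        strictMap_one, strictMap_ι_mul]
      congr 1
      generalize deconcat K V x = t
      induction t using TensorProduct.induction_on with
      | zero => simp
      | tmul y z => simp
      | add y z hy hz => simp only [map_add, hy, hz]
    | add x y hx hy => simp only [map_add, hx, hy]
    | smul r x hx => simp only [map_smul, hx]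
  map_one := strictMap_one g

theorem ιInv_strictMap (g : V →ₗ[K] H) (x : Words K V) :
    TensorAlgebra.ιInv (strictMap g x) = g (TensorAlgebra.ιInv x) := by
  induction x using words_induction with
  | one => simp [ιInv_one]
  | cons o x ih =>
    rw [strictMap_ι_mul, ιInv_ι_mul, ιInv_ι_mul, (isCohom_strictMap g).algebraMapInv, map_smul]
  | add x y hx hy => simp only [map_add, hx, hy]
  | smul r x hx => simp only [map_smul, hx]

theorem strictMap_mem_wordGrading {𝒱 : ℤ → Submodule K V} {ℋ : ℤ → Submodule K H}
    {g : V →ₗ[K] H} (hg : ∀ k, ∀ x ∈ 𝒱 k, g x ∈ ℋ k) :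
    ∀ p, ∀ x ∈ wordGrading 𝒱 p, strictMap g x ∈ wordGrading ℋ p := by
  intro p x hx
  refine wordGrading_induction (P := fun p x => strictMap g x ∈ wordGrading ℋ p) ?_ ?_ ?_ ?_ hx
  · rw [strictMap_one]; exact one_mem_wordGrading
  · intro a b o x ho _ ih
    rw [strictMap_ι_mul]
    exact mul_mem_wordGrading (ι_mem_wordGrading (hg a o ho)) ih
  · intro d x y hx hy
    rw [map_add]; exact add_mem hx hy
  · intro d r x hx
    rw [map_smul]; exact Submodule.smul_mem _ _ hx

theorem strictMap_mem_wordsBelow (g : V →ₗ[K] H) {n : ℕ} :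
    ∀ x ∈ wordsBelow K V n, strictMap g x ∈ wordsBelow K H n := by
  change wordsBelow K V n ≤ (wordsBelow K H n).comap (strictMap g)
  refine wordsBelow_le fun l hl => ?_
  rw [Submodule.mem_comap, strictMap_word]
  exact word_mem_wordsBelow (by simpa using hl)

theorem ιInv_ι (o : V) : TensorAlgebra.ιInv (TensorAlgebra.ι K o) = o := by
  have := ιInv_ι_mul (K := K) o 1
  simpa using this

/-- A cohomomorphism agrees with its linear part up to shorter words. -/
theorem IsCohom.sub_strictMap_mem {G : Words K V →ₗ[K] Words K H} (hG : IsCohom G)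
    {g : V →ₗ[K] H} (hg : ∀ o, TensorAlgebra.ιInv (G (TensorAlgebra.ι K o)) = g o) (l : List V) :
    G (word K l) - strictMap g (word K l) ∈ wordsBelow K H l.length := by
  induction h : l.length using Nat.strong_induction_on generalizing l with
  | _ n ih =>
    subst h
    have ih' : ∀ t : List V, t.length < l.length → G (word K t) ∈ wordsBelow K H (t.length + 1) := by
      intro t ht
      have h1 := wordsBelow_mono (Nat.le_succ _) (ih _ ht t rfl)
      have h2 := strictMap_mem_wordsBelow g _
        (word_mem_wordsBelow (K := K) (Nat.lt_succ_self t.length))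
      simpa using add_mem h1 h2
    rcases l with _ | ⟨o, t⟩
    · simp [hG.map_one]
    · have e := LinearMap.congr_fun hG.eq_add_conv (word K (o :: t))
      have h0 : TensorAlgebra.ιInv (G 1) = (0 : H) := hG.ιInv_one
      rw [LinearMap.add_apply, word_cons, augm_ι_mul, zero_add, ← word_cons, conv_word,
        List.length_cons, Finset.sum_range_succ', Finset.sum_range_succ'] at e
      simp only [List.take_zero, word_nil, LinearMap.comp_apply, h0, map_zero, zero_mul, add_zero,
        List.take_succ_cons, List.drop_succ_cons, List.drop_zero, zero_add, word_cons, mul_one,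
        hg] at e
      -- The one-letter prefix yields `g o` followed by `G` of the tail, handled by induction.
      -- Prefixes of at least two letters collapse to one letter, which shortens the word.
      rw [word_cons, e, strictMap_ι_mul, add_sub_assoc, ← mul_sub]
      refine add_mem (Submodule.sum_mem _ fun k hk => ?_)
        (ι_mul_mem_wordsBelow _ (ih _ (by simp) t rfl))
      rw [Finset.mem_range] at hk
      refine wordsBelow_mono ?_ (ι_mul_mem_wordsBelow _ (ih' (t.drop (k + 1)) ?_))
      · simp only [List.length_drop, List.length_cons]; omega
      · simp only [List.length_drop, List.length_cons]; omega

theorem IsCohom.sub_strictMap_lowers {G : Words K V →ₗ[K] Words K H} (hG : IsCohom G)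
    {g : V →ₗ[K] H} (hg : ∀ o, TensorAlgebra.ιInv (G (TensorAlgebra.ι K o)) = g o) {n : ℕ} :
    ∀ x ∈ wordsBelow K V (n + 1), G x - strictMap g x ∈ wordsBelow K H n := by
  change wordsBelow K V (n + 1) ≤ (wordsBelow K H n).comap (G - strictMap g)
  exact wordsBelow_le fun l hl =>
    wordsBelow_mono (Nat.lt_succ_iff.1 hl) (hG.sub_strictMap_mem hg l)

end Strict

/-! ### Changes of coordinates and transport of structure -/

section WordsIso

variable {K : Type w} [Field K] {V : Type v} [AddCommGroup V] [Module K V]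
  {H : Type u} [AddCommGroup H] [Module K H]

/-- Isomorphisms of graded tensor coalgebras. -/
structure WordsIso (𝒱 : ℤ → Submodule K V) (ℋ : ℤ → Submodule K H) where
  /-- the underlying cohomomorphism -/
  fwd : Words K V →ₗ[K] Words K H
  /-- its inverse -/
  inv : Words K H →ₗ[K] Words K V
  isCohom : IsCohom fwd
  fwd_mem : ∀ p, ∀ x ∈ wordGrading 𝒱 p, fwd x ∈ wordGrading ℋ p
  inv_mem : ∀ p, ∀ x ∈ wordGrading ℋ p, inv x ∈ wordGrading 𝒱 p
  inv_fwd : ∀ x, inv (fwd x) = x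
  fwd_inv : ∀ x, fwd (inv x) = x

/-- A cohomomorphism with invertible linear part is invertible. -/
theorem IsCohom.exists_wordsIso {G : Words K V →ₗ[K] Words K H} (hG : IsCohom G)
    {𝒱 : ℤ → Submodule K V} {ℋ : ℤ → Submodule K H}
    (hdeg : ∀ p, ∀ x ∈ wordGrading 𝒱 p, G x ∈ wordGrading ℋ p)
    {g : V →ₗ[K] H} (hg : ∀ o, TensorAlgebra.ιInv (G (TensorAlgebra.ι K o)) = g o)
    {k : H →ₗ[K] V} (hk : ∀ p, ∀ x ∈ ℋ p, k x ∈ 𝒱 p) (hkg : k ∘ₗ g = LinearMap.id)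
    (hgk : g ∘ₗ k = LinearMap.id) : ∃ e : WordsIso 𝒱 ℋ, e.fwd = G := by
  -- As `G` is `strictMap g` up to shorter words, `G x = 0` makes `strictMap g x` short; applying
  -- `strictMap k` shows that `x` itself is short.
  have inj : ∀ n, ∀ x ∈ wordsBelow K V n, G x = 0 → x = 0 := by
    intro n
    induction n with
    | zero =>
      intro x hx _
      rwa [wordsBelow_zero, Submodule.mem_bot] at hx
    | succ n ih =>
      intro x hx h0
      refine ih x ?_ h0
      have h1 := strictMap_mem_wordsBelow k _ (hG.sub_strictMap_lowers hg x hx)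
      rw [h0, zero_sub, map_neg, strictMap_comp, hkg, strictMap_id] at h1
      exact neg_mem_iff.1 h1
  -- The error of the approximate preimage `strictMap k y` is shorter than `y` and of the same
  -- degree; tracking the degree here makes the inverse homogeneous.
  have surj : ∀ n, ∀ y ∈ wordsBelow K H n, ∃ x, G x = y ∧
      ∀ p, y ∈ wordGrading ℋ p → x ∈ wordGrading 𝒱 p := by
    intro n
    induction n with
    | zero =>
      intro y hy
      rw [wordsBelow_zero, Submodule.mem_bot] at hy
      exact ⟨0, by simp [hy], fun p _ => zero_mem _⟩
    | succ n ih =>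
      intro y hy
      have h1 := hG.sub_strictMap_lowers hg _ (strictMap_mem_wordsBelow k _ hy)
      rw [strictMap_comp, hgk, strictMap_id] at h1
      obtain ⟨x, hx, hxd⟩ := ih _ h1
      refine ⟨strictMap k y - x, by rw [map_sub, hx]; abel, fun p hp => ?_⟩
      have h2 := strictMap_mem_wordGrading hk p y hp
      exact sub_mem h2 (hxd p (sub_mem (hdeg p _ h2) hp))
  have bij : Function.Bijective G := by
    constructor
    · refine (injective_iff_map_eq_zero G).2 fun x hx => ?_
      obtain ⟨n, hn⟩ := exists_mem_wordsBelow x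
      exact inj n x hn hx
    · intro y
      obtain ⟨n, hn⟩ := exists_mem_wordsBelow y
      obtain ⟨x, hx, _⟩ := surj n y hn
      exact ⟨x, hx⟩
  let e := LinearEquiv.ofBijective G bij
  refine ⟨⟨G, e.symm.toLinearMap, hG, hdeg, fun p y hy => ?_, fun x => e.symm_apply_apply x,
    fun x => e.apply_symm_apply x⟩, rfl⟩
  obtain ⟨n, hn⟩ := exists_mem_wordsBelow y
  obtain ⟨x, hx, hxd⟩ := surj n y hn
  have : e.symm y = x := by
    rw [LinearEquiv.symm_apply_eq]; exact hx.symm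
  change e.symm y ∈ _
  rw [this]
  exact hxd p hy

namespace WordsIso

variable {𝒱 : ℤ → Submodule K V} {ℋ : ℤ → Submodule K H}

/-- The inverse isomorphism. -/
def symm (e : WordsIso 𝒱 ℋ) : WordsIso ℋ 𝒱 where
  fwd := e.inv
  inv := e.fwd
  isCohom :=
    { comul := fun y => by
        have h := e.isCohom.comul (e.inv y)
        rw [e.fwd_inv] at h
        have h1 : e.inv ∘ₗ e.fwd = LinearMap.id := LinearMap.ext e.inv_fwd
        rw [h, tensorMap_map, h1, TensorProduct.map_id,
          LinearMap.id_apply]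
      map_one := by
        have := e.inv_fwd 1
        rwa [e.isCohom.map_one] at this }
  fwd_mem := e.inv_mem
  inv_mem := e.fwd_mem
  inv_fwd := e.fwd_inv
  fwd_inv := e.inv_fwd

variable [DirectSum.Decomposition 𝒱] [DirectSum.Decomposition ℋ]

/-- The `A_∞`-structure transported along an isomorphism of coalgebras. -/
def transport (e : WordsIso 𝒱 ℋ) (m : AInfStructure ℋ) : AInfStructure 𝒱 where
  d := e.inv ∘ₗ m.d ∘ₗ e.fwd
  degree_one p x hx := e.inv_mem _ _ (m.degree_one _ _ (e.fwd_mem p x hx))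
  coderivation x := by
    have h1 : e.inv ∘ₗ e.fwd = LinearMap.id := LinearMap.ext e.inv_fwd
    have h2 : e.inv ∘ₗ (wordSign ℋ).toLinearMap ∘ₗ e.fwd = (wordSign 𝒱).toLinearMap :=
      LinearMap.ext fun x => by
        simp only [LinearMap.comp_apply, AlgHom.toLinearMap_apply]
        rw [← wordSign_comm e.fwd_mem, e.inv_fwd]
    have h3 := e.symm.isCohom.comul (m.d (e.fwd x))
    change deconcat K V (e.inv _) = TensorProduct.map e.inv e.inv _ at h3
    rw [LinearMap.comp_apply, LinearMap.comp_apply, h3, m.coderivation, e.isCohom.comul]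
    simp only [map_add, tensorMap_map, LinearMap.id_comp, h1, h2]
  square_zero x := by
    simp only [LinearMap.comp_apply, e.fwd_inv, m.square_zero, map_zero]
  map_one := by
    simp only [LinearMap.comp_apply, e.isCohom.map_one, m.map_one, map_zero]

/-- The isomorphism from the transported `A_∞`-structure. -/
def transportHom (e : WordsIso 𝒱 ℋ) (m : AInfStructure ℋ) : AInfHom (e.transport m) m where
  toFun := e.fwd
  degree_zero := e.fwd_mem
  comul := e.isCohom.comul
  map_one := e.isCohom.map_one
  comm x := by simp only [transport, LinearMap.comp_apply, e.fwd_inv]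

/-- The isomorphism to the transported `A_∞`-structure. -/
def transportInvHom (e : WordsIso 𝒱 ℋ) (m : AInfStructure ℋ) : AInfHom m (e.transport m) where
  toFun := e.inv
  degree_zero := e.inv_mem
  comul := e.symm.isCohom.comul
  map_one := e.symm.isCohom.map_one
  comm x := by simp only [transport, LinearMap.comp_apply, e.fwd_inv]

theorem transportHom_comp_inv (e : WordsIso 𝒱 ℋ) (m : AInfStructure ℋ) :
    (e.transportHom m).comp (e.transportInvHom m) = AInfHom.id m :=
  AInfHom.ext (LinearMap.ext e.fwd_inv)

theorem transportInvHom_comp_hom (e : WordsIso 𝒱 ℋ) (m : AInfStructure ℋ) :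
    (e.transportInvHom m).comp (e.transportHom m) = AInfHom.id _ :=
  AInfHom.ext (LinearMap.ext e.inv_fwd)

end WordsIso

end WordsIso

/-! ### Coderivations and their leading terms -/

section Coderivations

variable {K : Type w} [Field K] {V : Type v} [AddCommGroup V] [Module K V]
  {H : Type u} [AddCommGroup H] [Module K H]
  {𝒱 : ℤ → Submodule K V} [DirectSum.Decomposition 𝒱]
  {ℋ : ℤ → Submodule K H} [DirectSum.Decomposition ℋ]

variable (ℋ) in
/-- Coderivations of odd degree vanishing on the empty word. -/
structure IsCoder (d : Words K H →ₗ[K] Words K H) : Prop where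
  comul : ∀ x, deconcat K H (d x) =
    TensorProduct.map d LinearMap.id (deconcat K H x) +
      TensorProduct.map (wordSign ℋ).toLinearMap d (deconcat K H x)
  map_one : d 1 = 0

theorem AInfStructure.isCoder (m : AInfStructure ℋ) : IsCoder ℋ m.d :=
  ⟨m.coderivation, m.map_one⟩

theorem IsCoder.sub {d d' : Words K H →ₗ[K] Words K H} (hd : IsCoder ℋ d) (hd' : IsCoder ℋ d') :
    IsCoder ℋ (d - d') where
  comul x := by
    rw [LinearMap.sub_apply, map_sub, hd.comul, hd'.comul]
    generalize deconcat K H x = t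
    induction t using TensorProduct.induction_on with
    | zero => simp
    | tmul y z => simp [TensorProduct.sub_tmul, TensorProduct.tmul_sub]; abel
    | add y z hy hz =>
      simp only [map_add]
      refine Eq.trans ?_ (Eq.trans (congrArg₂ (· + ·) hy hz) ?_) <;> abel
  map_one := by simp [hd.map_one, hd'.map_one]

theorem isCoder_zero : IsCoder ℋ (0 : Words K H →ₗ[K] Words K H) where
  comul x := by simp
  map_one := rfl

theorem concat_map_add (a b a' b' c : Words K V →ₗ[K] Words K H)
    (p : Words K H →ₗ[K] Words K H) (x : Words K V)
    (h : deconcat K H (c x) = TensorProduct.map a b (deconcat K V x) +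
      TensorProduct.map a' b' (deconcat K V x)) :
    conv p LinearMap.id (c x) = conv (p ∘ₗ a) b x + conv (p ∘ₗ a') b' x := by
  rw [conv_apply, h, conv_apply, conv_apply]
  induction deconcat K V x using TensorProduct.induction_on with
  | zero => simp
  | tmul y z => simp
  | add y z hy hz =>
    simp only [map_add] at hy hz ⊢
    rw [add_add_add_comm, hy, hz]
    abel

theorem algebraMapInv_wordSign (x : Words K H) :
    TensorAlgebra.algebraMapInv (wordSign ℋ x) = TensorAlgebra.algebraMapInv x :=
  (isCohom_strictMap (signMap ℋ)).algebraMapInv x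

/-- Applying `ε` to the left factor of the coderivation identity gives `d = (ε d) * id + d`, and
`id` can be cancelled from `(ε d) * id = 0`. -/
theorem IsCoder.algebraMapInv {d : Words K H →ₗ[K] Words K H} (hd : IsCoder ℋ d) (x : Words K H) :
    TensorAlgebra.algebraMapInv (d x) = 0 := by
  have key : (TensorAlgebra.algebraMapInv : Words K H →ₐ[K] K).toLinearMap ∘ₗ d = 0 := by
    refine eq_zero_of_conv_eq_zero (G := LinearMap.id) rfl ?_
    refine LinearMap.ext fun x => ?_
    have h := concat_map_add _ _ _ _ d (augm K H (Words K H)) x (hd.comul x)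
    have h1 : augm K H (Words K H) ∘ₗ (wordSign ℋ).toLinearMap = augm K H _ :=
      LinearMap.ext fun x => by
        simp only [LinearMap.comp_apply, AlgHom.toLinearMap_apply, augm_apply,
          algebraMapInv_wordSign]
    rw [h1, augm_conv, augm_conv, LinearMap.id_apply, right_eq_add] at h
    exact h
  exact LinearMap.congr_fun key x

/-- The failure of a cohomomorphism to commute with coderivations is determined by its linear
component. -/
theorem IsCohom.commutator_eq {G : Words K V →ₗ[K] Words K H} (hG : IsCohom G)
    (hdeg : ∀ p, ∀ x ∈ wordGrading 𝒱 p, G x ∈ wordGrading ℋ p)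
    {d : Words K V →ₗ[K] Words K V} (hd : IsCoder 𝒱 d)
    {d' : Words K H →ₗ[K] Words K H} (hd' : IsCoder ℋ d')
    {E : Words K V →ₗ[K] Words K H} (hE : E = G ∘ₗ d - d' ∘ₗ G) :
    E = conv (TensorAlgebra.ι K ∘ₗ TensorAlgebra.ιInv ∘ₗ E) G +
      conv (TensorAlgebra.ι K ∘ₗ TensorAlgebra.ιInv ∘ₗ G ∘ₗ (wordSign 𝒱).toLinearMap) E := by
  -- The defect is a coderivation along `G`; the terms in which both factors are acted on only by
  -- `G` and signs do not occur.
  have comul : ∀ x, deconcat K H (E x) = TensorProduct.map E G (deconcat K V x) +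
      TensorProduct.map (G ∘ₗ (wordSign 𝒱).toLinearMap) E (deconcat K V x) := by
    intro x
    have hS : (wordSign ℋ).toLinearMap ∘ₗ G = G ∘ₗ (wordSign 𝒱).toLinearMap :=
      LinearMap.ext fun y => (wordSign_comm hdeg y).symm
    rw [hE, LinearMap.sub_apply, map_sub, LinearMap.comp_apply, LinearMap.comp_apply, hG.comul,
      hd.comul, hd'.comul, hG.comul, map_add]
    simp only [tensorMap_map]
    rw [hS]
    generalize deconcat K V x = t
    induction t using TensorProduct.induction_on with
    | zero => simp
    | tmul y z => simp [TensorProduct.sub_tmul, TensorProduct.tmul_sub]; abel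
    | add y z hy hz =>
      simp only [map_add]
      refine Eq.trans ?_ (Eq.trans (congrArg₂ (· + ·) hy hz) ?_) <;> abel
  refine LinearMap.ext fun x => ?_
  nth_rw 1 [← augm_add_conv (E x)]
  have h0 : augm K H (Words K H) (E x) = 0 := by
    rw [augm_apply, hE, LinearMap.sub_apply, map_sub, LinearMap.comp_apply, LinearMap.comp_apply,
      hG.algebraMapInv, hd.algebraMapInv, hd'.algebraMapInv, sub_zero, map_zero]
  rw [h0, zero_add, concat_map_add _ _ _ _ E _ x (comul x)]
  rfl

/-- This is `IsCohom.commutator_eq` for the identity and the zero coderivation. In its second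
convolution only the one-letter prefix has a letter component. -/
theorem IsCoder.apply_ι_mul {d : Words K H →ₗ[K] Words K H} (hd : IsCoder ℋ d) (o : H)
    (x : Words K H) :
    d (TensorAlgebra.ι K o * x) =
      conv (TensorAlgebra.ι K ∘ₗ TensorAlgebra.ιInv ∘ₗ d) LinearMap.id (TensorAlgebra.ι K o * x) +
        TensorAlgebra.ι K (signMap ℋ o) * d x := by
  have h := IsCohom.id.commutator_eq (fun _ _ h => h) hd isCoder_zero (E := d) (by simp)
  nth_rw 1 [h]
  rw [LinearMap.add_apply, conv_ι_mul _ d]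
  have h1 : (TensorAlgebra.ι K ∘ₗ TensorAlgebra.ιInv ∘ₗ LinearMap.id ∘ₗ
      (wordSign ℋ).toLinearMap) ∘ₗ LinearMap.mulLeft K (TensorAlgebra.ι K o) =
      LinearMap.mulLeft K (TensorAlgebra.ι K (signMap ℋ o)) ∘ₗ augm K H (Words K H) := by
    refine LinearMap.ext fun y => ?_
    simp only [LinearMap.comp_apply, LinearMap.mulLeft_apply, LinearMap.id_apply,
      AlgHom.toLinearMap_apply, wordSign_ι_mul, ιInv_ι_mul, algebraMapInv_wordSign, augm_apply,
      map_smul, Algebra.algebraMap_eq_smul_one, mul_one]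
  rw [h1, conv_mulLeft, augm_conv]
  simp [AInf.ιInv_one]

/-- A coderivation without linear component shortens words. -/
theorem IsCoder.lowers {d : Words K H →ₗ[K] Words K H} (hd : IsCoder ℋ d)
    (h1 : ∀ o, TensorAlgebra.ιInv (d (TensorAlgebra.ι K o)) = 0) {n : ℕ} :
    ∀ x ∈ wordsBelow K H (n + 1), d x ∈ wordsBelow K H n := by
  suffices key : ∀ l : List H, d (word K l) ∈ wordsBelow K H l.length by
    change wordsBelow K H (n + 1) ≤ (wordsBelow K H n).comap d
    exact wordsBelow_le fun l hl => wordsBelow_mono (Nat.lt_succ_iff.1 hl) (key l)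
  intro l
  induction l with
  | nil => simp [hd.map_one]
  | cons o t ih =>
    rw [word_cons, hd.apply_ι_mul, ← word_cons, conv_word]
    refine add_mem (Submodule.sum_mem _ fun k hk => ?_) (ι_mul_mem_wordsBelow _ ih)
    rw [Finset.mem_range, List.length_cons] at hk
    -- Prefixes of length zero and one contribute nothing, by `d 1 = 0` and `h1`; a longer prefix is
    -- replaced by a single letter.
    rcases k with _ | _ | k
    · simp [hd.map_one]
    · simp [h1]
    · refine wordsBelow_mono ?_ (ι_mul_mem_wordsBelow _
        (word_mem_wordsBelow (Nat.lt_succ_self _)))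
      simp only [List.length_drop, List.length_cons]
      omega

/-- Left concatenation by a letter for `twistedDer`. -/
noncomputable def twistedStep (d s : H →ₗ[K] H) : H →ₗ[K] Module.End K (Words K H × Words K H) where
  toFun o :=
    LinearMap.prod (LinearMap.mulLeft K (TensorAlgebra.ι K o) ∘ₗ LinearMap.fst K _ _)
      (LinearMap.mulLeft K (TensorAlgebra.ι K (d o)) ∘ₗ LinearMap.fst K _ _ +
        LinearMap.mulLeft K (TensorAlgebra.ι K (s o)) ∘ₗ LinearMap.snd K _ _)
  map_add' a b := by
    refine LinearMap.ext fun x => Prod.ext ?_ ?_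
    · simp [add_mul]
    · simp [add_mul]; abel
  map_smul' r a := by
    refine LinearMap.ext fun x => Prod.ext ?_ ?_ <;> simp

/-- The linear map `δ` on `C(H)` with `δ(1) = 0` and `δ(o x) = d(o) x + s(o) δ(x)`. -/
noncomputable def twistedDer (d s : H →ₗ[K] H) : Words K H →ₗ[K] Words K H :=
  LinearMap.snd K _ _ ∘ₗ LinearMap.applyₗ ((1 : Words K H), (0 : Words K H)) ∘ₗ
    (TensorAlgebra.lift K (twistedStep d s)).toLinearMap

@[simp]
theorem twistedDer_one (d s : H →ₗ[K] H) : twistedDer d s 1 = 0 := by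
  simp [twistedDer]

@[simp]
theorem twistedDer_ι_mul (d s : H →ₗ[K] H) (o : H) (x : Words K H) :
    twistedDer d s (TensorAlgebra.ι K o * x) =
      TensorAlgebra.ι K (d o) * x + TensorAlgebra.ι K (s o) * twistedDer d s x := by
  have key : ∀ (x : Words K H) (y : Words K H × Words K H),
      (TensorAlgebra.lift K (twistedStep d s) x y).1 = x * y.1 := by
    intro x
    induction x using TensorAlgebra.induction with
    | algebraMap r => intro p; simp [Algebra.smul_def]
    | ι o => intro p; simp [twistedStep]
    | mul a b ha hb => intro p; simp [ha, hb, mul_assoc]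
    | add a b ha hb => intro p; simp [ha, hb, add_mul]
  have h := key x (1, 0)
  rw [mul_one] at h
  have e : ∀ y, twistedDer d s y = (TensorAlgebra.lift K (twistedStep d s) y (1, 0)).2 :=
    fun _ => rfl
  rw [e, map_mul, Module.End.mul_apply, TensorAlgebra.lift_ι_apply, e x]
  nth_rw 2 [← h]
  rfl

@[simp]
theorem twistedDer_ι (d s : H →ₗ[K] H) (o : H) :
    twistedDer d s (TensorAlgebra.ι K o) = TensorAlgebra.ι K (d o) := by
  have := twistedDer_ι_mul d s o 1
  simpa using this

theorem algebraMapInv_twistedDer (d s : H →ₗ[K] H) (x : Words K H) :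
    TensorAlgebra.algebraMapInv (twistedDer d s x) = 0 := by
  induction x using words_induction with
  | one => simp
  | cons o x ih => rw [twistedDer_ι_mul, map_add, algebraMapInv_ι_mul, algebraMapInv_ι_mul, add_zero]
  | add x y hx hy => simp only [map_add, hx, hy, add_zero]
  | smul r x hx => simp only [map_smul, hx, smul_zero]

theorem ιInv_twistedDer (d s : H →ₗ[K] H) (x : Words K H) :
    TensorAlgebra.ιInv (twistedDer d s x) = d (TensorAlgebra.ιInv x) := by
  induction x using words_induction with
  | one => simp [ιInv_one]
  | cons o x ih =>
    rw [twistedDer_ι_mul, map_add, ιInv_ι_mul, ιInv_ι_mul, ιInv_ι_mul, algebraMapInv_twistedDer,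
      zero_smul, add_zero, map_smul]
  | add x y hx hy => simp only [map_add, hx, hy]
  | smul r x hx => simp only [map_smul, hx]

omit [DirectSum.Decomposition ℋ] in
theorem twistedDer_mem_wordGrading {d s : H →ₗ[K] H} {k : ℤ}
    (hd : ∀ p, ∀ x ∈ ℋ p, d x ∈ ℋ (p + k)) (hs : ∀ p, ∀ x ∈ ℋ p, s x ∈ ℋ p) :
    ∀ p, ∀ x ∈ wordGrading ℋ p, twistedDer d s x ∈ wordGrading ℋ (p + k) := by
  intro p x hx
  refine wordGrading_induction (P := fun p x => twistedDer d s x ∈ wordGrading ℋ (p + k))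
    ?_ ?_ ?_ ?_ hx
  · rw [twistedDer_one]; exact zero_mem _
  · intro a b o x ho hx ih
    rw [twistedDer_ι_mul]
    refine add_mem ?_ ?_
    · rw [add_right_comm]
      exact mul_mem_wordGrading (ι_mem_wordGrading (hd a o ho)) hx
    · rw [add_assoc]
      exact mul_mem_wordGrading (ι_mem_wordGrading (hs a o ho)) ih
  · intro d x y hx hy
    rw [map_add]; exact add_mem hx hy
  · intro d r x hx
    rw [map_smul]; exact Submodule.smul_mem _ _ hx

theorem twistedDer_mem_wordsBelow (d s : H →ₗ[K] H) {n : ℕ} :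
    ∀ x ∈ wordsBelow K H n, twistedDer d s x ∈ wordsBelow K H n := by
  suffices key : ∀ l : List H, twistedDer d s (word K l) ∈ wordsBelow K H (l.length + 1) by
    change wordsBelow K H n ≤ (wordsBelow K H n).comap (twistedDer d s)
    exact wordsBelow_le fun l hl => wordsBelow_mono hl (key l)
  intro l
  induction l with
  | nil => simp
  | cons o t ih =>
    rw [word_cons, twistedDer_ι_mul]
    exact add_mem (ι_mul_mem_wordsBelow _ (word_mem_wordsBelow (Nat.lt_succ_self _)))
      (ι_mul_mem_wordsBelow _ ih)

theorem isCoder_twistedDer (d : H →ₗ[K] H) : IsCoder ℋ (twistedDer d (signMap ℋ)) where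
  comul x := by
    induction x using words_induction with
    | one => simp
    | cons o x ih =>
      rw [twistedDer_ι_mul, map_add, deconcat_ι_mul, deconcat_ι_mul, deconcat_ι_mul, ih]
      simp only [map_add, TensorProduct.map_tmul, twistedDer_one, TensorProduct.zero_tmul,
        AlgHom.toLinearMap_apply, map_one, twistedDer_ι_mul, TensorProduct.tmul_add]
      have e1 : ∀ t, TensorProduct.map (twistedDer d (signMap ℋ)) LinearMap.id
          (LinearMap.rTensor (Words K H) (LinearMap.mulLeft K (TensorAlgebra.ι K o)) t) =
          LinearMap.rTensor (Words K H) (LinearMap.mulLeft K (TensorAlgebra.ι K (d o))) t +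
          LinearMap.rTensor (Words K H) (LinearMap.mulLeft K (TensorAlgebra.ι K (signMap ℋ o)))
            (TensorProduct.map (twistedDer d (signMap ℋ)) LinearMap.id t) := by
        intro t
        induction t using TensorProduct.induction_on with
        | zero => simp
        | tmul y z => simp [TensorProduct.add_tmul]
        | add y z hy hz => simp only [map_add, hy, hz]; abel
      have e2 : ∀ t, TensorProduct.map (wordSign ℋ).toLinearMap (twistedDer d (signMap ℋ))
          (LinearMap.rTensor (Words K H) (LinearMap.mulLeft K (TensorAlgebra.ι K o)) t) =
          LinearMap.rTensor (Words K H) (LinearMap.mulLeft K (TensorAlgebra.ι K (signMap ℋ o)))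
            (TensorProduct.map (wordSign ℋ).toLinearMap (twistedDer d (signMap ℋ)) t) := by
        intro t
        induction t using TensorProduct.induction_on with
        | zero => simp
        | tmul y z => simp
        | add y z hy hz => simp only [map_add, hy, hz]
      rw [e1, e2]
      abel
    | add x y hx hy => simp only [map_add, hx, hy]; abel
    | smul r x hx => simp only [map_smul, hx, smul_add]
  map_one := twistedDer_one _ _

end Coderivations

/-! ### Contraction of the complex onto the minimal model -/

section Hodge

variable {K : Type w} [Field K] {V : Type v} [AddCommGroup V] [Module K V]
  {H : Type u} [AddCommGroup H] [Module K H]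
  {𝒱 : ℤ → Submodule K V} [DirectSum.Decomposition 𝒱]
  {ℋ : ℤ → Submodule K H} [DirectSum.Decomposition ℋ]

theorem exists_linearMap_grading {M : Type*} [AddCommMonoid M] [Module K M]
    (s : ∀ k, ℋ k →ₗ[K] M) : ∃ g : H →ₗ[K] M, ∀ k (y : ℋ k), g y = s k y := by
  refine ⟨DirectSum.toModule K ℤ M s ∘ₗ (DirectSum.decomposeLinearEquiv ℋ).toLinearMap,
    fun k y => ?_⟩
  have h := DirectSum.decomposeLinearEquiv_apply_coe (R := K) ℋ k y
  rw [LinearMap.comp_apply, LinearEquiv.coe_coe, h, DirectSum.toModule_lof]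

theorem exists_generalizedInverse {A B : Type*} [AddCommGroup A] [Module K A] [AddCommGroup B]
    [Module K B] (f : A →ₗ[K] B) : ∃ g : B →ₗ[K] A, ∀ x, f (g (f x)) = f x := by
  obtain ⟨s, hs⟩ := f.rangeRestrict.exists_rightInverse_of_surjective
    (LinearMap.range_rangeRestrict f)
  obtain ⟨g, hg⟩ := s.exists_extend
  refine ⟨g, fun x => ?_⟩
  have h1 : g (f x) = s (f.rangeRestrict x) := LinearMap.congr_fun hg (f.rangeRestrict x)
  have h2 := congrArg Subtype.val (LinearMap.congr_fun hs (f.rangeRestrict x))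
  rw [h1]
  exact h2

/-- Homogeneous linear maps have homogeneous generalized inverses. -/
theorem exists_graded_generalizedInverse (f : V →ₗ[K] H) (d : ℤ)
    (hf : ∀ k, ∀ x ∈ 𝒱 k, f x ∈ ℋ (k + d)) :
    ∃ g : H →ₗ[K] V, (∀ k, ∀ y ∈ ℋ k, g y ∈ 𝒱 (k - d)) ∧ ∀ x, f (g (f x)) = f x := by
  have hf' : ∀ k, ∀ x ∈ 𝒱 (k - d), f x ∈ ℋ k := fun k x hx => by
    simpa using hf (k - d) x hx
  choose s hs using fun k => exists_generalizedInverse (f.restrict (hf' k))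
  obtain ⟨g, hg⟩ := exists_linearMap_grading (ℋ := ℋ) fun k => (𝒱 (k - d)).subtype ∘ₗ s k
  refine ⟨g, fun k y hy => ?_, fun x => ?_⟩
  · rw [hg k ⟨y, hy⟩]
    exact (s k ⟨y, hy⟩).2
  · have : f ∘ₗ g ∘ₗ f = f := by
      refine linearMap_ext_grading 𝒱 fun k x hx => ?_
      have hx' : x ∈ 𝒱 (k + d - d) := by simpa using hx
      have h := congrArg Subtype.val (hs (k + d) ⟨x, hx'⟩)
      rw [LinearMap.comp_apply, LinearMap.comp_apply, hg (k + d) ⟨f x, hf k x hx⟩]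
      exact h
    exact LinearMap.congr_fun this x

theorem AInfStructure.m₁_mem (m : AInfStructure ℋ) : ∀ k, ∀ x ∈ ℋ k, m.m₁ x ∈ ℋ (k + 1) :=
  fun k _ hx => ιInv_mem (m.degree_one k _ (ι_mem_wordGrading hx))

variable {p : AInfStructure 𝒱} {m : AInfStructure ℋ}

theorem AInfHom.f₁_mem (F : AInfHom p m) : ∀ k, ∀ x ∈ 𝒱 k, F.f₁ x ∈ ℋ k :=
  fun k _ hx => ιInv_mem (F.degree_zero k _ (ι_mem_wordGrading hx))

/-- By minimality the cohomology of `p` is `V` itself, so this is injectivity on cohomology. -/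
theorem AInfHom.eq_zero_of_f₁_eq_m₁ (hp : p.IsMinimal) {F : AInfHom p m} (hF : F.IsQuasiIso)
    {v : V} {y : H} (h : F.f₁ v = m.m₁ y) : v = 0 := by
  have hv : v ∈ LinearMap.ker p.m₁ := by
    rw [LinearMap.mem_ker, show p.m₁ = 0 from hp, LinearMap.zero_apply]
  have h0 : F.cohomologyMap (Submodule.Quotient.mk ⟨v, hv⟩) = 0 := by
    refine (Submodule.Quotient.mk_eq_zero _).2 ?_
    exact ⟨y, h.symm⟩
  have h1 := hF.1 (h0.trans (map_zero F.cohomologyMap).symm)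
  obtain ⟨w, hw⟩ := (Submodule.Quotient.mk_eq_zero _).1 h1
  have h2 : p.m₁ w = 0 := by rw [show p.m₁ = 0 from hp, LinearMap.zero_apply]
  exact hw.symm.trans h2

theorem AInfHom.exists_eq_f₁_add_m₁ {F : AInfHom p m} (hF : F.IsQuasiIso)
    {z : H} (hz : m.m₁ z = 0) : ∃ v y, z = F.f₁ v + m.m₁ y := by
  obtain ⟨c, hc⟩ := hF.2 (Submodule.Quotient.mk ⟨z, hz⟩)
  obtain ⟨⟨v, hv⟩, rfl⟩ := Submodule.Quotient.mk_surjective _ c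
  obtain ⟨y, hy⟩ := (Submodule.Quotient.eq _).1 hc.symm
  exact ⟨v, y, by rw [show m.m₁ y = z - F.f₁ v from hy]; abel⟩

/-- A contraction of the complex `(H, d)` onto the graded vector space `V` (with zero differential)
along `i : V → H`. -/
structure Contraction (ℋ : ℤ → Submodule K H) (d : H →ₗ[K] H) (𝒱 : ℤ → Submodule K V)
    (i : V →ₗ[K] H) where
  /-- the retraction -/
  q : H →ₗ[K] V
  /-- the homotopy -/
  h : H →ₗ[K] H
  q_mem : ∀ k, ∀ x ∈ ℋ k, q x ∈ 𝒱 k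
  h_mem : ∀ k, ∀ x ∈ ℋ k, h x ∈ ℋ (k - 1)
  q_i : ∀ v, q (i v) = v
  homotopy : ∀ x, d (h x) + h (d x) = x - i (q x)
  h_h : ∀ x, h (h x) = 0
  q_h : ∀ x, q (h x) = 0
  h_i : ∀ v, h (i v) = 0
  q_d : ∀ x, q (d x) = 0

/-- Homogeneous generalized inverses replace a choice of Hodge decomposition: one of `m₁` provides
the homotopy, and one of `f₁` modulo coboundaries provides the retraction. -/
theorem AInfHom.exists_contraction (hp : p.IsMinimal) {F : AInfHom p m} (hF : F.IsQuasiIso) :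
    Nonempty (Contraction ℋ m.m₁ 𝒱 F.f₁) := by
  obtain ⟨σ, hσ, hσm⟩ := exists_graded_generalizedInverse (𝒱 := ℋ) (ℋ := ℋ) m.m₁ 1 m.m₁_mem
  have mf : ∀ v, m.m₁ (F.f₁ v) = 0 := fun v => by
    rw [← F.f₁_m₁, show p.m₁ = 0 from hp, LinearMap.zero_apply, map_zero]
  -- The map `1 - m₁ σ` kills coboundaries. If `u v = 0` then `f₁ v` is a coboundary, so `v = 0`;
  -- thus a generalized inverse of `u` is a left inverse.
  let u : V →ₗ[K] H := F.f₁ - m.m₁ ∘ₗ σ ∘ₗ F.f₁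
  have hu : ∀ v, u v = F.f₁ v - m.m₁ (σ (F.f₁ v)) := fun _ => rfl
  have hmσ : ∀ k, ∀ x ∈ ℋ k, m.m₁ (σ x) ∈ ℋ k := fun k x hx => by
    simpa using m.m₁_mem _ _ (hσ k x hx)
  have hσm' : ∀ k, ∀ x ∈ ℋ k, σ (m.m₁ x) ∈ ℋ k := fun k x hx => by
    simpa using hσ _ _ (m.m₁_mem k x hx)
  obtain ⟨r, hr, hru⟩ := exists_graded_generalizedInverse (𝒱 := 𝒱) (ℋ := ℋ) u 0 (fun k x hx => by
    rw [add_zero, hu]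
    exact sub_mem (F.f₁_mem k x hx) (hmσ k _ (F.f₁_mem k x hx)))
  have hru' : ∀ v, r (u v) = v := fun v => by
    have h1 := hru v
    rw [← sub_eq_zero, ← map_sub, hu, sub_eq_zero] at h1
    exact sub_eq_zero.1 (AInfHom.eq_zero_of_f₁_eq_m₁ hp hF h1)
  -- Passing from `σ` to `σ m₁ σ` gains `τ m₁ τ = τ`, from which `q τ = 0` and `h h = 0` follow.
  let τ : H →ₗ[K] H := σ ∘ₗ m.m₁ ∘ₗ σ
  have hτ : ∀ x, τ x = σ (m.m₁ (σ x)) := fun _ => rfl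
  have hτm : ∀ x, m.m₁ (τ (m.m₁ x)) = m.m₁ x := fun x => by rw [hτ, hσm, hσm]
  have hτmτ : ∀ x, τ (m.m₁ (τ x)) = τ x := fun x => by rw [hτ, hτ, hσm, hσm]
  let q : H →ₗ[K] V := r ∘ₗ (LinearMap.id - m.m₁ ∘ₗ σ) ∘ₗ (LinearMap.id - τ ∘ₗ m.m₁)
  have hq : ∀ x, q x = r ((x - τ (m.m₁ x)) - m.m₁ (σ (x - τ (m.m₁ x)))) := fun _ => rfl
  have hζ : ∀ k, ∀ x ∈ ℋ k, x - τ (m.m₁ x) ∈ ℋ k := fun k x hx =>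
    sub_mem hx (hσm' k _ (hσm' k x hx))
  have q_mem : ∀ k, ∀ x ∈ ℋ k, q x ∈ 𝒱 k := fun k x hx => by
    have h1 := hr k _ (sub_mem (hζ k x hx) (hmσ k _ (hζ k x hx)))
    rwa [sub_zero] at h1
  have q_f : ∀ v, q (F.f₁ v) = v := fun v => by
    rw [hq, mf, map_zero, sub_zero, ← hu, hru']
  have q_m : ∀ x, q (m.m₁ x) = 0 := fun x => by
    rw [hq, m.m₁_m₁, map_zero, sub_zero, hσm, sub_self, map_zero]
  have q_τ : ∀ x, q (τ x) = 0 := fun x => by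
    rw [hq, hτmτ, sub_self, map_zero, map_zero, sub_zero, map_zero]
  let h : H →ₗ[K] H := τ ∘ₗ (LinearMap.id - τ ∘ₗ m.m₁ - F.f₁ ∘ₗ q)
  have hh : ∀ x, h x = τ (x - τ (m.m₁ x) - F.f₁ (q x)) := fun _ => rfl
  refine ⟨⟨q, h, fun k x hx => ?_, fun k x hx => ?_, q_f, fun x => ?_, fun x => ?_, fun x => ?_,
    fun v => ?_, q_m⟩⟩
  · exact q_mem k x hx
  · have h1 : ∀ y ∈ ℋ k, τ y ∈ ℋ (k - 1) := fun y hy => hσ k _ (hmσ k y hy)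
    exact h1 _ (sub_mem (hζ k x hx) (F.f₁_mem k _ (q_mem k x hx)))
  -- The cocycle `x - τ m₁ x` equals `f₁ v + m₁ y`, and `q` identifies `v` as `q x`. Hence `m₁ h x =
  -- m₁ y`, while `h m₁ x = τ m₁ x`.
  · obtain ⟨v, y, hvy⟩ := AInfHom.exists_eq_f₁_add_m₁ (F := F) hF (z := x - τ (m.m₁ x))
      (by rw [map_sub, hτm, sub_self])
    have h1 : q x = v := by
      have h2 := congrArg q hvy
      rwa [map_sub, q_τ, sub_zero, map_add, q_f, q_m, add_zero] at h2
    rw [hh, hvy, h1, add_sub_cancel_left, hτm, hh, m.m₁_m₁, map_zero, sub_zero, q_m, map_zero,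
      sub_zero, ← sub_eq_iff_eq_add'.2 hvy]
    abel
  · rw [hh (h x), hh x, hτmτ, q_τ, map_zero, sub_self, sub_zero, map_zero]
  · rw [hh, q_τ]
  · rw [hh, mf, q_f, map_zero, sub_zero, sub_self, map_zero]

end Hodge

/-! ### Making a morphism strict -/

section Straightening

variable {K : Type w} [Field K] {V : Type v} [AddCommGroup V] [Module K V]
  {H : Type u} [AddCommGroup H] [Module K H]
  {𝒱 : ℤ → Submodule K V} [DirectSum.Decomposition 𝒱]
  {ℋ : ℤ → Submodule K H} [DirectSum.Decomposition ℋ]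
  {p : AInfStructure 𝒱} {m : AInfStructure ℋ}

theorem AInfHom.isCohom (F : AInfHom p m) : IsCohom F.toFun := ⟨F.comul, F.map_one⟩

/-- After a change of coordinates, a morphism whose linear part has a retraction becomes strict. -/
theorem AInfHom.exists_straightening (F : AInfHom p m) {q : H →ₗ[K] V}
    (hq : ∀ k, ∀ x ∈ ℋ k, q x ∈ 𝒱 k) (hqf : ∀ v, q (F.f₁ v) = v) :
    ∃ e : WordsIso ℋ ℋ, (∀ x, e.fwd (strictMap F.f₁ x) = F.toFun x) ∧
      ∀ o, TensorAlgebra.ιInv (e.fwd (TensorAlgebra.ι K o)) = o := by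
  -- The higher components of `F` are extended from `V` to `H` by precomposing with `q`, and the
  -- linear component is corrected to the identity. Restriction along `f₁` gives back the components
  -- of `F`, since `q f₁ = 1`.
  let φ : Words K H →ₗ[K] H := TensorAlgebra.ιInv +
    (TensorAlgebra.ιInv ∘ₗ F.toFun ∘ₗ strictMap q - F.f₁ ∘ₗ q ∘ₗ TensorAlgebra.ιInv)
  have hφ : ∀ x, φ x = TensorAlgebra.ιInv x +
    (TensorAlgebra.ιInv (F.toFun (strictMap q x)) - F.f₁ (q (TensorAlgebra.ιInv x))) :=
    fun _ => rfl
  have φ_one : φ 1 = 0 := by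
    rw [hφ, strictMap_one, F.map_one, AInf.ιInv_one]
    simp
  have φ_ι : ∀ o, φ (TensorAlgebra.ι K o) = o := fun o => by
    rw [hφ, strictMap_ι, F.toFun_ι, ιInv_ι, ιInv_ι, sub_self, add_zero]
  have φ_mem : ∀ k, ∀ x ∈ wordGrading ℋ k, φ x ∈ ℋ k := fun k x hx => by
    rw [hφ]
    exact add_mem (ιInv_mem hx) (sub_mem
      (ιInv_mem (F.degree_zero k _ (strictMap_mem_wordGrading hq k x hx)))
      (F.f₁_mem k _ (hq k _ (ιInv_mem hx))))
  have hπ : ∀ x, TensorAlgebra.ιInv (cohomLift φ x) = φ x :=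
    LinearMap.congr_fun (ιInv_comp_cohomLift φ_one)
  obtain ⟨e, he⟩ := (isCohom_cohomLift φ_one).exists_wordsIso (cohomLift_mem φ_one φ_mem)
    (g := LinearMap.id) (k := LinearMap.id) (fun o => by rw [hπ, φ_ι, LinearMap.id_apply])
    (fun _ _ h => h) rfl rfl
  refine ⟨e, fun x => ?_, fun o => by rw [he, hπ, φ_ι]⟩
  have hqf' : q ∘ₗ F.f₁ = LinearMap.id := LinearMap.ext hqf
  have key : e.fwd ∘ₗ strictMap F.f₁ = F.toFun := by
    refine (e.isCohom.comp (isCohom_strictMap _)).ext F.isCohom (LinearMap.ext fun x => ?_)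
    simp only [LinearMap.comp_apply]
    rw [he, hπ, hφ, strictMap_comp, hqf', strictMap_id, ιInv_strictMap, hqf]
    abel
  exact LinearMap.congr_fun key x

end Straightening

/-! ### The tensor trick -/

section Retraction

variable {K : Type w} [Field K] {V : Type v} [AddCommGroup V] [Module K V]
  {H : Type u} [AddCommGroup H] [Module K H]
  {𝒱 : ℤ → Submodule K V}
  {ℋ : ℤ → Submodule K H} [DirectSum.Decomposition ℋ]
  {d : H →ₗ[K] H} {i : V →ₗ[K] H}

namespace Contraction

variable (c : Contraction ℋ d 𝒱 i)

/-- The homotopy on words obtained from a contraction by the tensor trick. -/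
noncomputable def wordHomotopy : Words K H →ₗ[K] Words K H :=
  twistedDer c.h (i ∘ₗ c.q ∘ₗ signMap ℋ)

theorem wordHomotopy_one : c.wordHomotopy 1 = 0 := twistedDer_one _ _

theorem wordHomotopy_ι_mul (o : H) (x : Words K H) :
    c.wordHomotopy (TensorAlgebra.ι K o * x) = TensorAlgebra.ι K (c.h o) * x +
      TensorAlgebra.ι K (i (c.q (signMap ℋ o))) * c.wordHomotopy x :=
  twistedDer_ι_mul _ _ _ _

theorem h_signMap (x : H) : c.h (signMap ℋ x) = - signMap ℋ (c.h x) :=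
  signMap_anticomm (d := -1) (by decide) (fun k x hx => by simpa [sub_eq_add_neg] using c.h_mem k x hx) x

theorem wordHomotopy_mem (hi : ∀ k, ∀ x ∈ 𝒱 k, i x ∈ ℋ k) :
    ∀ p, ∀ x ∈ wordGrading ℋ p, c.wordHomotopy x ∈ wordGrading ℋ (p - 1) := by
  intro p x hx
  rw [sub_eq_add_neg]
  exact twistedDer_mem_wordGrading (fun k x hx => by simpa [sub_eq_add_neg] using c.h_mem k x hx)
    (fun k x hx => hi k _ (c.q_mem k _ (signMap_mem hx))) p x hx

theorem wordHomotopy_strictMap (x : Words K V) : c.wordHomotopy (strictMap i x) = 0 := by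
  induction x using words_induction with
  | one => rw [strictMap_one, wordHomotopy_one]
  | cons o x ih => rw [strictMap_ι_mul, wordHomotopy_ι_mul, ih, c.h_i]; simp
  | add x y hx hy => simp only [map_add, hx, hy, add_zero]
  | smul r x hx => simp only [map_smul, hx, smul_zero]

variable [DirectSum.Decomposition 𝒱]

theorem q_signMap (x : H) : c.q (signMap ℋ x) = signMap 𝒱 (c.q x) := signMap_comm c.q_mem x

theorem wordHomotopy_wordHomotopy (x : Words K H) : c.wordHomotopy (c.wordHomotopy x) = 0 := by
  induction x using words_induction with
  | one => rw [wordHomotopy_one, map_zero]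
  | cons o x ih =>
    rw [wordHomotopy_ι_mul, map_add, wordHomotopy_ι_mul, wordHomotopy_ι_mul, ih, c.h_h, c.h_i,
      q_signMap, c.q_h]
    simp
  | add x y hx hy => simp only [map_add, hx, hy, add_zero]
  | smul r x hx => simp only [map_smul, hx, smul_zero]

/-- The tensor trick: `b ĥ + ĥ b = 1 - (i q)_*`. -/
theorem word_homotopy (hd : ∀ k, ∀ x ∈ ℋ k, d x ∈ ℋ (k + 1)) (hi : ∀ k, ∀ x ∈ 𝒱 k, i x ∈ ℋ k)
    (hdi : ∀ v, d (i v) = 0) (x : Words K H) :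
    twistedDer d (signMap ℋ) (c.wordHomotopy x) + c.wordHomotopy (twistedDer d (signMap ℋ) x) =
      x - strictMap i (strictMap c.q x) := by
  induction x using words_induction with
  | one => simp [wordHomotopy_one]
  | cons o x ih =>
    have h1 : d (signMap ℋ o) = - signMap ℋ (d o) := signMap_anticomm odd_one hd o
    have hs : ∀ v, signMap ℋ (i (signMap 𝒱 v)) = i v := fun v => by
      rw [signMap_comm hi, signMap_signMap]
    have h2 : TensorAlgebra.ι K (d (c.h o)) + TensorAlgebra.ι K (c.h (d o)) =
        TensorAlgebra.ι K o - TensorAlgebra.ι K (i (c.q o)) := by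
      rw [← map_add, c.homotopy, map_sub]
    -- As `h` is odd, the cross terms with `h o` in front of `b x` cancel, and those with `d` next
    -- to `i q` vanish. What remains is `(d h + h d)(o) x + i q(o) (b ĥ + ĥ b) x`.
    simp only [wordHomotopy_ι_mul, twistedDer_ι_mul, map_add, strictMap_ι_mul, hdi, q_signMap, hs,
      c.h_signMap, c.q_d, signMap_signMap, map_zero, zero_mul, map_neg, neg_mul]
    have h3 := congrArg (TensorAlgebra.ι K (i (c.q o)) * ·) ih
    have h4 := congrArg (· * x) h2
    simp only [mul_add, mul_sub, add_mul, sub_mul] at h3 h4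
    refine Eq.trans ?_ (Eq.trans (congrArg₂ (· + ·) h4 h3) ?_) <;> abel
  | add x y hx hy =>
    simp only [map_add]
    refine Eq.trans ?_ (Eq.trans (congrArg₂ (· + ·) hx hy) ?_) <;> abel
  | smul r x hx => simp only [map_smul, ← smul_add, hx, smul_sub]

end Contraction

end Retraction

/-! ### The strict left inverse -/

section Retraction

variable {K : Type w} [Field K] {V : Type v} [AddCommGroup V] [Module K V]
  {H : Type u} [AddCommGroup H] [Module K H]
  {𝒱 : ℤ → Submodule K V} [DirectSum.Decomposition 𝒱]
  {ℋ : ℤ → Submodule K H} [DirectSum.Decomposition ℋ]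

/-- Components with the value on the empty word removed. -/
noncomputable def reduced (g : Words K H →ₗ[K] V) : Words K H →ₗ[K] V :=
  g - LinearMap.toSpanSingleton K V (g 1) ∘ₗ
    (TensorAlgebra.algebraMapInv : Words K H →ₐ[K] K).toLinearMap

theorem reduced_apply (g : Words K H →ₗ[K] V) (x : Words K H) :
    reduced g x = g x - TensorAlgebra.algebraMapInv x • g 1 := rfl

theorem reduced_one (g : Words K H →ₗ[K] V) : reduced g 1 = 0 := by
  rw [reduced_apply, map_one (TensorAlgebra.algebraMapInv : Words K H →ₐ[K] K), one_smul, sub_self]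

theorem reduced_eq_self {g : Words K H →ₗ[K] V} (hg : g 1 = 0) : reduced g = g :=
  LinearMap.ext fun x => by rw [reduced_apply, hg, smul_zero, sub_zero]

theorem reduced_congr {g g' : Words K H →ₗ[K] V} {n : ℕ}
    (h : ∀ x ∈ wordsBelow K H n, g x = g' x) :
    ∀ x ∈ wordsBelow K H n, reduced g x = reduced g' x := by
  intro x hx
  rcases n with _ | n
  · rw [wordsBelow_zero, Submodule.mem_bot] at hx
    rw [hx, map_zero, map_zero]
  · rw [reduced_apply, reduced_apply, h x hx,
      h 1 (word_mem_wordsBelow (l := ([] : List H)) (Nat.succ_pos n))]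

omit [DirectSum.Decomposition 𝒱] [DirectSum.Decomposition ℋ] in
theorem reduced_mem {g : Words K H →ₗ[K] V} (hg : ∀ k, ∀ x ∈ wordGrading ℋ k, g x ∈ 𝒱 k) :
    ∀ k, ∀ x ∈ wordGrading ℋ k, reduced g x ∈ 𝒱 k := by
  intro k x hx
  rw [reduced_apply]
  refine sub_mem (hg k x hx) ?_
  by_cases hk : k = 0
  · subst hk
    exact Submodule.smul_mem _ _ (hg 0 _ one_mem_wordGrading)
  · rw [algebraMapInv_of_mem hk hx, zero_smul]
    exact zero_mem _

variable {p : AInfStructure 𝒱} {D : AInfStructure ℋ}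

/-- The nonlinear part of a codifferential. -/
noncomputable def AInfStructure.nonlinear (D : AInfStructure ℋ) : Words K H →ₗ[K] Words K H :=
  D.d - twistedDer D.m₁ (signMap ℋ)

theorem AInfStructure.nonlinear_lowers (D : AInfStructure ℋ) {n : ℕ} :
    ∀ x ∈ wordsBelow K H (n + 1), D.nonlinear x ∈ wordsBelow K H n :=
  (D.isCoder.sub (isCoder_twistedDer _)).lowers fun o => by
    rw [LinearMap.sub_apply, D.d_ι, twistedDer_ι, sub_self, map_zero]

theorem AInfStructure.nonlinear_mem (D : AInfStructure ℋ) :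
    ∀ k, ∀ x ∈ wordGrading ℋ k, D.nonlinear x ∈ wordGrading ℋ (k + 1) := fun k x hx =>
  sub_mem (D.degree_one k x hx)
    (twistedDer_mem_wordGrading D.m₁_mem (fun _ _ h => signMap_mem h) k x hx)

/-- The components of a retraction onto a minimal `A_∞`-algebra `p`, as a solution of
`g = q π + (π p G(g) - g D'') ĥ`. -/
theorem Contraction.exists_components {i : V →ₗ[K] H} (c : Contraction ℋ D.m₁ 𝒱 i)
    (hi : ∀ k, ∀ x ∈ 𝒱 k, i x ∈ ℋ k) (hp : p.IsMinimal) :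
    ∃ g : Words K H →ₗ[K] V, g 1 = 0 ∧ (∀ k, ∀ x ∈ wordGrading ℋ k, g x ∈ 𝒱 k) ∧
      ∀ x, g x = c.q (TensorAlgebra.ιInv x) +
        (TensorAlgebra.ιInv (p.d (cohomLift g (c.wordHomotopy x))) -
          g (D.nonlinear (c.wordHomotopy x))) := by
  -- The operator has to be defined for every `g`, whereas `cohomLift` needs components vanishing on
  -- the empty word; the fixed point itself satisfies `g 1 = 0`, so there `reduced` has no effect.
  let T : (Words K H →ₗ[K] V) → (Words K H →ₗ[K] V) := fun g =>
    c.q ∘ₗ TensorAlgebra.ιInv + (TensorAlgebra.ιInv ∘ₗ p.d ∘ₗ cohomLift (reduced g) -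
      g ∘ₗ D.nonlinear) ∘ₗ c.wordHomotopy
  have hT : ∀ g x, T g x = c.q (TensorAlgebra.ιInv x) +
      (TensorAlgebra.ιInv (p.d (cohomLift (reduced g) (c.wordHomotopy x))) -
        g (D.nonlinear (c.wordHomotopy x))) := fun _ _ => rfl
  obtain ⟨g, hg, hloc⟩ := exists_fixedPoint T (by
      intro n f f' h x hx
      have hy : c.wordHomotopy x ∈ wordsBelow K H (n + 1) := twistedDer_mem_wordsBelow _ _ x hx
      -- On words one letter longer, the two lifts differ by a single letter, which `p.d` kills by
      -- minimality; in the other term, `D.nonlinear` shortens the argument.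
      have h1 := cohomLift_sub (reduced_one f) (reduced_one f') (reduced_congr h) _ hy
      have h2 := congrArg p.d h1
      rw [p.d_ι, show p.m₁ = 0 from hp, LinearMap.zero_apply, map_zero, map_sub,
        sub_eq_zero] at h2
      rw [hT, hT, h _ (D.nonlinear_lowers _ hy), h2])
    (fun g => ∀ k, ∀ x ∈ wordGrading ℋ k, g x ∈ 𝒱 k) (fun _ _ _ => zero_mem _)
    (fun g hg k x hx => by
      have hy := c.wordHomotopy_mem hi k x hx
      have h1 := p.degree_one _ _ (cohomLift_mem (reduced_one g) (reduced_mem hg) _ _ hy)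
      have h2 := D.nonlinear_mem _ _ hy
      rw [sub_add_cancel] at h1 h2
      rw [hT]
      exact add_mem (c.q_mem k _ (ιInv_mem hx)) (sub_mem (ιInv_mem h1) (hg k _ h2)))
  have g_one : g 1 = 0 := by
    rw [← hg, hT, c.wordHomotopy_one]
    simp [ιInv_one]
  refine ⟨g, g_one, fun k => ?_, fun x => ?_⟩
  · change wordGrading ℋ k ≤ (𝒱 k).comap g
    refine wordGrading_le fun l e hl he => ?_
    obtain ⟨g', hg', h⟩ := hloc (l.length + 1)
    rw [Submodule.mem_comap, h _ (word_mem_wordsBelow (Nat.lt_succ_self _))]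
    exact hg' k _ (he ▸ word_mem_wordGrading hl)
  · nth_rw 1 [← hg]
    rw [hT, reduced_eq_self g_one]

/-- A strict morphism from a minimal `A_∞`-algebra whose linear part is the inclusion of a
contraction has a retraction. -/
theorem AInfHom.exists_retraction_of_strict (hp : p.IsMinimal) (J : AInfHom p D)
    (hJ : J.toFun = strictMap J.f₁) (c : Contraction ℋ D.m₁ 𝒱 J.f₁) :
    ∃ G : AInfHom D p, G.comp J = AInfHom.id p := by
  obtain ⟨g, g_one, g_mem, hg⟩ := c.exists_components (p := p) J.f₁_mem hp
  have hGc := isCohom_cohomLift g_one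
  have hGd := cohomLift_mem g_one g_mem
  have hGπ : ∀ x, TensorAlgebra.ιInv (cohomLift g x) = g x :=
    LinearMap.congr_fun (ιInv_comp_cohomLift g_one)
  set G := cohomLift g
  have hdi : ∀ v, D.m₁ (J.f₁ v) = 0 := fun v => by
    rw [← J.f₁_m₁, show p.m₁ = 0 from hp, LinearMap.zero_apply, map_zero]
  have g_i : ∀ x, g (strictMap J.f₁ x) = TensorAlgebra.ιInv x := fun x => by
    rw [hg, c.wordHomotopy_strictMap, ιInv_strictMap, c.q_i]
    simp
  have G_i : ∀ x, G (strictMap J.f₁ x) = x := by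
    have key : G ∘ₗ strictMap J.f₁ = LinearMap.id := by
      refine (hGc.comp (isCohom_strictMap _)).ext IsCohom.id (LinearMap.ext fun x => ?_)
      simp only [LinearMap.comp_apply, LinearMap.id_apply]
      rw [hGπ, g_i]
    exact LinearMap.congr_fun key
  let E : Words K H →ₗ[K] Words K V := G ∘ₗ D.d - p.d ∘ₗ G
  have hE : ∀ x, E x = G (D.d x) - p.d (G x) := fun _ => rfl
  have hEeq := hGc.commutator_eq hGd D.isCoder p.isCoder (E := E) rfl
  have E_i : ∀ x, E (strictMap J.f₁ x) = 0 := fun x => by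
    rw [hE, G_i, ← hJ, ← J.comm, hJ, G_i, sub_self]
  have g_h : ∀ x, g (c.wordHomotopy x) = 0 := fun x => by
    rw [hg, c.wordHomotopy_wordHomotopy, Contraction.wordHomotopy, ιInv_twistedDer, c.q_h]
    simp
  have hsplit : ∀ x, D.d x = twistedDer D.m₁ (signMap ℋ) x + D.nonlinear x := fun x => by
    rw [AInfStructure.nonlinear, LinearMap.sub_apply]; abel
  -- The homotopy identity and `g ĥ = 0` give `g b ĥ = g - q π`, so this is exactly the defining
  -- equation of `g`.
  have e_h : ∀ x, TensorAlgebra.ιInv (E (c.wordHomotopy x)) = 0 := fun x => by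
    have h1 := c.word_homotopy D.m₁_mem J.f₁_mem hdi x
    rw [← eq_sub_iff_add_eq] at h1
    rw [hE, map_sub, hGπ, hsplit, map_add, h1, map_sub, map_sub, g_i, g_h, ιInv_strictMap]
    nth_rw 1 [hg x]
    abel
  have E_d : ∀ x, E (D.d x) = - p.d (E x) := fun x => by
    rw [hE, hE, D.square_zero, map_sub, p.square_zero, map_zero]
    abel
  -- Decompose `x = b ĥ x + ĥ b x + i_* q_* x`. The last two terms are covered by `e_h` and `E_i`,
  -- leaving `b ĥ x`.
  have e_zero : ∀ n, ∀ x ∈ wordsBelow K H n, TensorAlgebra.ιInv (E x) = 0 := by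
    intro n
    induction n with
    | zero =>
      intro x hx
      rw [wordsBelow_zero, Submodule.mem_bot] at hx
      rw [hx, map_zero, map_zero]
    | succ n ih =>
      intro x hx
      have hy : c.wordHomotopy x ∈ wordsBelow K H (n + 1) := twistedDer_mem_wordsBelow _ _ x hx
      have h1 := c.word_homotopy D.m₁_mem J.f₁_mem hdi x
      have h2 : E (c.wordHomotopy x) = 0 := by
        rw [eq_ι_of_eq_conv hEeq hGc.map_one ?_ ih _ hy]
        · rw [LinearMap.comp_apply, e_h, map_zero]
        · simp [hGc.map_one, ιInv_one]
      -- From `E D = -p E` and `E ĥ x = 0` one gets `E b ĥ x = -E D'' ĥ x`, where `D'' ĥ x` is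
      -- shorter.
      have h3 : TensorAlgebra.ιInv (E (twistedDer D.m₁ (signMap ℋ) (c.wordHomotopy x))) = 0 := by
        have h4 := congrArg E (hsplit (c.wordHomotopy x))
        rw [E_d, h2, map_zero, neg_zero, map_add] at h4
        rw [eq_neg_of_add_eq_zero_left h4.symm, map_neg, ih _ (D.nonlinear_lowers _ hy), neg_zero]
      have h5 := congrArg (fun y => TensorAlgebra.ιInv (E y)) h1
      simp only [map_add, map_sub, E_i, e_h, h3, sub_zero, add_zero] at h5
      exact h5.symm
  refine ⟨⟨G, hGd, hGc.comul, hGc.map_one, fun x => ?_⟩, ?_⟩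
  · obtain ⟨n, hn⟩ := exists_mem_wordsBelow x
    have h1 := eq_ι_of_eq_conv hEeq hGc.map_one (by simp [hGc.map_one, ιInv_one])
      (e_zero n) x (wordsBelow_mono (Nat.le_succ n) hn)
    rw [LinearMap.comp_apply, e_zero n x hn, map_zero, hE, sub_eq_zero] at h1
    exact h1
  · refine AInfHom.ext (LinearMap.ext fun x => ?_)
    change G (J.toFun x) = x
    rw [hJ, G_i]

end Retraction

/-! ### Composition, quasi-isomorphisms and retractions of minimal models -/

section Minimal

variable {K : Type w} [Field K] {V : Type v} [AddCommGroup V] [Module K V]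
  {H : Type u} [AddCommGroup H] [Module K H] {W : Type v'} [AddCommGroup W] [Module K W]
  {𝒱 : ℤ → Submodule K V} [DirectSum.Decomposition 𝒱]
  {ℋ : ℤ → Submodule K H} [DirectSum.Decomposition ℋ]
  {𝒲 : ℤ → Submodule K W} [DirectSum.Decomposition 𝒲]
  {p : AInfStructure 𝒱} {m : AInfStructure ℋ} {q : AInfStructure 𝒲}

theorem AInfHom.f₁_comp (G : AInfHom m q) (F : AInfHom p m) (x : V) :
    (G.comp F).f₁ x = G.f₁ (F.f₁ x) := by
  change TensorAlgebra.ιInv (G.toFun (F.toFun (TensorAlgebra.ι K x))) = _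
  rw [F.toFun_ι, G.toFun_ι, ιInv_ι]

theorem AInfHom.f₁_id (x : V) : (AInfHom.id p).f₁ x = x := ιInv_ι x

theorem AInfHom.cohomologyMap_comp (G : AInfHom m q) (F : AInfHom p m) :
    (G.comp F).cohomologyMap = G.cohomologyMap ∘ₗ F.cohomologyMap := by
  refine LinearMap.ext fun x => ?_
  obtain ⟨x, rfl⟩ := Submodule.Quotient.mk_surjective _ x
  exact congrArg Submodule.Quotient.mk (Subtype.ext (G.f₁_comp F x))

theorem AInfHom.cohomologyMap_id : (AInfHom.id p).cohomologyMap = LinearMap.id := by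
  refine LinearMap.ext fun x => ?_
  obtain ⟨x, rfl⟩ := Submodule.Quotient.mk_surjective _ x
  exact congrArg Submodule.Quotient.mk (Subtype.ext (AInfHom.f₁_id (p := p) (x : V)))

theorem AInfHom.isIso_of_inverse {F : AInfHom p m} {G : AInfHom m p}
    (h1 : G.comp F = AInfHom.id p) (h2 : F.comp G = AInfHom.id m) : F.IsIso := by
  refine Function.bijective_iff_has_inverse.2 ⟨G.f₁, fun x => ?_, fun x => ?_⟩
  · rw [← AInfHom.f₁_comp, h1, AInfHom.f₁_id]
  · rw [← AInfHom.f₁_comp, h2, AInfHom.f₁_id]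

theorem AInfHom.IsIso.comp {G : AInfHom m q} {F : AInfHom p m} (hG : G.IsIso) (hF : F.IsIso) :
    (G.comp F).IsIso := by
  have : ⇑(G.comp F).f₁ = G.f₁ ∘ F.f₁ := funext (AInfHom.f₁_comp G F)
  rw [AInfHom.IsIso, this]
  exact Function.Bijective.comp hG hF

theorem AInfHom.isInverseQuasiIso_of_comp_eq_id {F : AInfHom p m} {G : AInfHom m p}
    (hF : F.IsQuasiIso) (h : G.comp F = AInfHom.id p) : G.IsInverseQuasiIso F := by
  have h1 : G.cohomologyMap ∘ₗ F.cohomologyMap = LinearMap.id := by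
    rw [← AInfHom.cohomologyMap_comp, h, AInfHom.cohomologyMap_id]
  have h2 : F.cohomologyMap ∘ₗ G.cohomologyMap = LinearMap.id := by
    refine LinearMap.ext fun y => ?_
    obtain ⟨x, rfl⟩ := hF.2 y
    exact congrArg F.cohomologyMap (LinearMap.congr_fun h1 x)
  exact ⟨Function.bijective_iff_has_inverse.2
    ⟨F.cohomologyMap, LinearMap.congr_fun h2, LinearMap.congr_fun h1⟩, h1, h2⟩

/-- Quasi-isomorphisms between minimal `A_∞`-algebras are isomorphisms. -/
theorem AInfHom.isIso_of_isMinimal (hp : p.IsMinimal) (hm : m.IsMinimal) {F : AInfHom p m}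
    (hF : F.IsQuasiIso) : F.IsIso := by
  constructor
  · refine (injective_iff_map_eq_zero F.f₁).2 fun v hv => ?_
    exact AInfHom.eq_zero_of_f₁_eq_m₁ hp hF (y := 0) (by rw [hv, map_zero])
  · intro z
    have hz : ∀ y, m.m₁ y = 0 := fun y => by rw [show m.m₁ = 0 from hm, LinearMap.zero_apply]
    obtain ⟨v, y, h⟩ := AInfHom.exists_eq_f₁_add_m₁ hF (hz z)
    exact ⟨v, by rw [h, hz, add_zero]⟩

/-- In suitable coordinates, a minimal model is the inclusion of a contraction. -/
theorem AInfHom.exists_strict_model (hp : p.IsMinimal) {F : AInfHom p m} (hF : F.IsQuasiIso) :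
    ∃ (D : AInfStructure ℋ) (A : AInfHom D m) (B : AInfHom m D) (J : AInfHom p D),
      A.comp B = AInfHom.id m ∧ B.comp A = AInfHom.id D ∧ J = B.comp F ∧
        J.toFun = strictMap J.f₁ ∧ Nonempty (Contraction ℋ D.m₁ 𝒱 J.f₁) := by
  obtain ⟨c⟩ := AInfHom.exists_contraction hp hF
  obtain ⟨e, he, he1⟩ := F.exists_straightening c.q_mem c.q_i
  have hJ : ((e.transportInvHom m).comp F).toFun = strictMap F.f₁ := LinearMap.ext fun x => by
    change e.inv (F.toFun x) = _
    rw [← he, e.inv_fwd]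
  have hJ1 : ((e.transportInvHom m).comp F).f₁ = F.f₁ := LinearMap.ext fun x => by
    rw [AInfHom.f₁, hJ]
    simp [ιInv_ι]
  have hD : (e.transport m).m₁ = m.m₁ := LinearMap.ext fun o => by
    have h := (e.transportHom m).f₁_m₁ o
    have h1 : ∀ o, (e.transportHom m).f₁ o = o := he1
    rwa [h1, h1] at h
  refine ⟨e.transport m, e.transportHom m, e.transportInvHom m, (e.transportInvHom m).comp F,
    e.transportHom_comp_inv m, e.transportInvHom_comp_hom m, rfl, ?_, ?_⟩
  · rw [hJ, hJ1]
  · rw [hJ1, hD]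
    exact ⟨c⟩

theorem AInfHom.id_comp (F : AInfHom p m) : (AInfHom.id m).comp F = F := rfl

/-- A minimal model has a strict left inverse. -/
theorem AInfHom.exists_retraction (hp : p.IsMinimal) {F : AInfHom p m} (hF : F.IsQuasiIso) :
    ∃ G : AInfHom m p, G.comp F = AInfHom.id p := by
  -- A retraction of the strict model `B.comp F` becomes one of `F` after composition with the
  -- coordinate change `B`.
  obtain ⟨D, A, B, J, _, _, rfl, hs, ⟨c⟩⟩ := AInfHom.exists_strict_model hp hF
  obtain ⟨G, hG⟩ := AInfHom.exists_retraction_of_strict hp _ hs c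
  exact ⟨G.comp B, hG⟩

end Minimal

/-! ### Complexes as linear algebras -/

section Linear

variable {K : Type w} [Field K] {C : Type u} [AddCommGroup C] [Module K C]
  {𝒞 : ℤ → Submodule K C} [DirectSum.Decomposition 𝒞]

/-- A complex as an `A_∞`-algebra. -/
noncomputable def linearStructure (𝒞 : ℤ → Submodule K C) [DirectSum.Decomposition 𝒞]
    (d : C →ₗ[K] C) (hd : ∀ k, ∀ x ∈ 𝒞 k, d x ∈ 𝒞 (k + 1)) (hdd : ∀ x, d (d x) = 0) :
    AInfStructure 𝒞 where
  d := twistedDer d (signMap 𝒞)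
  degree_one := twistedDer_mem_wordGrading hd fun _ _ h => signMap_mem h
  coderivation := (isCoder_twistedDer d).comul
  square_zero x := by
    induction x using words_induction with
    | one => simp
    | cons o x ih =>
      simp only [twistedDer_ι_mul, map_add, ih, hdd, signMap_anticomm odd_one hd, map_zero,
        zero_mul, mul_zero, map_neg, neg_mul]
      abel
    | add x y hx hy => simp only [map_add, hx, hy, add_zero]
    | smul r x hx => simp only [map_smul, hx, smul_zero]
  map_one := twistedDer_one _ _

variable {d : C →ₗ[K] C} (hd : ∀ k, ∀ x ∈ 𝒞 k, d x ∈ 𝒞 (k + 1)) (hdd : ∀ x, d (d x) = 0)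

theorem ιInv_linearStructure_d (x : Words K C) :
    TensorAlgebra.ιInv ((linearStructure 𝒞 d hd hdd).d x) = d (TensorAlgebra.ιInv x) :=
  ιInv_twistedDer _ _ x

theorem linearStructure_m₁ (x : C) : (linearStructure 𝒞 d hd hdd).m₁ x = d x := by
  change TensorAlgebra.ιInv ((linearStructure 𝒞 d hd hdd).d (TensorAlgebra.ι K x)) = _
  rw [ιInv_linearStructure_d, ιInv_ι]

theorem ιInv_tprod {k : ℕ} (hk : 2 ≤ k) (o : Fin k → C) :
    TensorAlgebra.ιInv (TensorAlgebra.tprod K C k o) = 0 := by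
  obtain ⟨k, rfl⟩ := Nat.exists_eq_add_of_le' hk
  rw [← word_ofFn, List.ofFn_succ, List.ofFn_succ, word_cons, word_cons, ιInv_ι_mul,
    algebraMapInv_ι_mul, zero_smul]

theorem isLinearContractible_linearStructure (h : ∀ x, d x = 0 → ∃ y, d y = x) :
    (linearStructure 𝒞 d hd hdd).IsLinearContractible := by
  refine ⟨fun k hk => MultilinearMap.ext fun o => ?_, ⟨fun a b => ?_⟩⟩
  · change TensorAlgebra.ιInv ((linearStructure 𝒞 d hd hdd).d _) = 0
    rw [ιInv_linearStructure_d, ιInv_tprod hk, map_zero]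
  · have zero : ∀ a : (linearStructure 𝒞 d hd hdd).Cohomology, a = 0 := by
      intro a
      obtain ⟨⟨x, hx⟩, rfl⟩ := Submodule.Quotient.mk_surjective _ a
      refine (Submodule.Quotient.mk_eq_zero _).2 ?_
      rw [LinearMap.mem_ker, linearStructure_m₁] at hx
      obtain ⟨y, hy⟩ := h x hx
      exact ⟨y, (linearStructure_m₁ hd hdd y).trans hy⟩
    rw [zero a, zero b]

end Linear

/-! ### Splitting off the linear contractible summand -/

section Decomposition

variable {K : Type w} [Field K] {V : Type v} [AddCommGroup V] [Module K V]
  {H : Type u} [AddCommGroup H] [Module K H]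
  {𝒱 : ℤ → Submodule K V} [DirectSum.Decomposition 𝒱]
  {ℋ : ℤ → Submodule K H} [DirectSum.Decomposition ℋ]
  {p : AInfStructure 𝒱} {D : AInfStructure ℋ}

/-- The image of a homogeneous projection is graded. -/
theorem nonempty_decomposition_comap (N : Submodule K H) (e : H →ₗ[K] N)
    (he : ∀ k, ∀ x ∈ ℋ k, (e x : H) ∈ ℋ k) (hN : ∀ x : N, e x = x) :
    Nonempty (DirectSum.Decomposition fun k => (ℋ k).comap N.subtype) := by
  obtain ⟨g, hg⟩ := exists_linearMap_grading (ℋ := ℋ) fun k =>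
    DirectSum.lof K ℤ (fun k => (ℋ k).comap N.subtype) k ∘ₗ
      LinearMap.codRestrict ((ℋ k).comap N.subtype) (e ∘ₗ (ℋ k).subtype)
        fun x => he k x x.2
  refine ⟨DirectSum.Decomposition.ofLinearMap (R := K) _ (g ∘ₗ N.subtype) ?_ ?_⟩
  · have h : DirectSum.coeLinearMap (fun k => (ℋ k).comap N.subtype) ∘ₗ g = e := by
      refine linearMap_ext_grading ℋ fun k x hx => ?_
      rw [LinearMap.comp_apply, hg k ⟨x, hx⟩, LinearMap.comp_apply, DirectSum.coeLinearMap_lof]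
      rfl
    rw [← LinearMap.comp_assoc, h]
    exact LinearMap.ext hN
  · refine DirectSum.linearMap_ext K fun k => LinearMap.ext fun x => ?_
    simp only [LinearMap.comp_apply, DirectSum.coeLinearMap_lof, LinearMap.id_apply]
    rw [show N.subtype x = ((⟨N.subtype x, x.2⟩ : ℋ k) : H) from rfl, hg, LinearMap.comp_apply]
    congr 1
    exact Subtype.ext (hN x)

/-- The retraction `G` supplies the minimal coordinate. The contractible coordinate takes values in
`ker q`, a subcomplex because `q m₁ = 0`, and comes from a null-homotopic cochain that vanishes on
the image of `J`. -/
theorem AInfHom.exists_factorization_of_strict (J : AInfHom p D)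
    (hJ : J.toFun = strictMap J.f₁) (c : Contraction ℋ D.m₁ 𝒱 J.f₁) (G : AInfHom D p)
    (hG : G.comp J = AInfHom.id p) :
    ∃ (C : Type u) (_ : AddCommGroup C) (_ : Module K C)
        (𝒞 : ℤ → Submodule K C) (_ : DirectSum.Decomposition 𝒞)
        (n : AInfStructure 𝒞) (S : AInfStructure (prodGrading 𝒱 𝒞))
        (I : AInfHom p S) (A : AInfHom S D),
        n.IsLinearContractible ∧ S.IsDirectSum p n ∧ I.IsInclusion ∧ A.IsIso ∧
          J = A.comp I := by
  have hGJ : ∀ x, G.toFun (J.toFun x) = x :=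
    LinearMap.congr_fun (congrArg AInfHom.toFun hG)
  have hGi : ∀ v, G.f₁ (J.f₁ v) = v := fun v => by rw [← AInfHom.f₁_comp, hG, AInfHom.f₁_id]
  let N : Submodule K H := LinearMap.ker c.q
  let pr : H →ₗ[K] N := LinearMap.codRestrict N (LinearMap.id - J.f₁ ∘ₗ c.q) fun x => by
    simp [N, c.q_i]
  have hpr : ∀ x, (pr x : H) = x - J.f₁ (c.q x) := fun _ => rfl
  let 𝒞 : ℤ → Submodule K N := fun k => (ℋ k).comap N.subtype
  obtain ⟨dec⟩ := nonempty_decomposition_comap (ℋ := ℋ) N pr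
    (fun k x hx => sub_mem hx (J.f₁_mem k _ (c.q_mem k x hx)))
    (fun x => Subtype.ext (by rw [hpr, show c.q x = 0 from x.2, map_zero, sub_zero]))
  let hC : H →ₗ[K] N := LinearMap.codRestrict N c.h c.q_h
  let dC : N →ₗ[K] N := LinearMap.codRestrict N (D.m₁ ∘ₗ N.subtype) fun x => c.q_d x
  have dC_mem : ∀ k, ∀ x ∈ 𝒞 k, dC x ∈ 𝒞 (k + 1) := fun k x hx => D.m₁_mem k _ hx
  have hC_mem : ∀ k, ∀ x ∈ ℋ k, hC x ∈ 𝒞 (k - 1) := fun k x hx => c.h_mem k x hx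
  have dC_dC : ∀ x, dC (dC x) = 0 := fun x => Subtype.ext (D.m₁_m₁ _)
  let n := linearStructure 𝒞 dC dC_mem dC_dC
  -- This is the coboundary of `h π`: `γ D = dC γ` is automatic from `D D = 0` and `dC dC = 0`, and
  -- the linear part `m₁ h + h m₁` is the projection `1 - i q` onto `ker q`.
  let γ : Words K H →ₗ[K] N :=
    dC ∘ₗ hC ∘ₗ TensorAlgebra.ιInv + hC ∘ₗ TensorAlgebra.ιInv ∘ₗ D.d
  have hγ : ∀ x, γ x = dC (hC (TensorAlgebra.ιInv x)) + hC (TensorAlgebra.ιInv (D.d x)) :=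
    fun _ => rfl
  let ψ : Words K H →ₗ[K] V × N := LinearMap.prod (TensorAlgebra.ιInv ∘ₗ G.toFun) γ
  have hψ : ∀ x, ψ x = (TensorAlgebra.ιInv (G.toFun x), γ x) := fun _ => rfl
  have ψ_one : ψ 1 = 0 := by
    rw [hψ, hγ, G.map_one, D.map_one, ιInv_one, ιInv_one]
    simp
  have ψ_mem : ∀ k, ∀ x ∈ wordGrading ℋ k, ψ x ∈ prodGrading 𝒱 𝒞 k := fun k x hx => by
    refine ⟨ιInv_mem (G.degree_zero k x hx), ?_⟩
    have h1 := dC_mem _ _ (hC_mem k _ (ιInv_mem hx))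
    have h2 := hC_mem _ _ (ιInv_mem (D.degree_one k x hx))
    rw [sub_add_cancel] at h1
    rw [add_sub_cancel_right] at h2
    exact add_mem h1 h2
  have γ_ι : ∀ o, γ (TensorAlgebra.ι K o) = pr o := fun o => by
    rw [hγ, D.d_ι, ιInv_ι, ιInv_ι]
    exact Subtype.ext (c.homotopy o)
  let g : H →ₗ[K] V × N := LinearMap.prod G.f₁ pr
  -- The linear part of `G` need not vanish on `ker q`, so a vector of `N` is corrected by its
  -- `G.f₁`-component before it is used as the second coordinate.
  let k : V × N →ₗ[K] H := LinearMap.coprod J.f₁ (N.subtype - J.f₁ ∘ₗ G.f₁ ∘ₗ N.subtype)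
  have hk : ∀ y, k y = J.f₁ y.1 + ((y.2 : H) - J.f₁ (G.f₁ (y.2 : H))) := fun _ => rfl
  have hcoh := isCohom_cohomLift ψ_one
  have hπ : ∀ x, TensorAlgebra.ιInv (cohomLift ψ x) = ψ x :=
    LinearMap.congr_fun (ιInv_comp_cohomLift ψ_one)
  obtain ⟨e, he⟩ := hcoh.exists_wordsIso (cohomLift_mem ψ_one ψ_mem) (g := g) (k := k)
    (fun o => by rw [hπ, hψ, γ_ι]; rfl)
    (fun j y hy => add_mem (J.f₁_mem j _ hy.1)
      (sub_mem hy.2 (J.f₁_mem j _ (G.f₁_mem j _ hy.2))))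
    (LinearMap.ext fun x => by
      change k (G.f₁ x, pr x) = x
      rw [hk]
      simp only [hpr, map_sub, hGi]
      abel)
    (LinearMap.ext fun y => by
      have h1 : c.q (y.2 : H) = 0 := y.2.2
      refine Prod.ext ?_ (Subtype.ext ?_)
      · change G.f₁ (k y) = y.1
        rw [hk, map_add, map_sub, hGi, hGi, sub_self, add_zero]
      · change (pr (k y) : H) = y.2
        rw [hpr, hk]
        simp only [map_add, map_sub, c.q_i, h1]
        simp)
  have hπ' : ∀ x, TensorAlgebra.ιInv (e.fwd x) = ψ x := by rwa [he]
  let S := e.symm.transport D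
  let I : AInfHom p S := (e.symm.transportInvHom D).comp J
  have hI : I.toFun = strictMap (LinearMap.inl K V N) := by
    refine (e.isCohom.comp J.isCohom).ext (isCohom_strictMap _) (LinearMap.ext fun x => ?_)
    simp only [LinearMap.comp_apply]
    -- By strictness `h π J = h i π`, which is zero; the other term reduces to this one because `D J
    -- = J p`.
    have h1 : γ (J.toFun x) = 0 := by
      have h2 : ∀ y, hC (TensorAlgebra.ιInv (J.toFun y)) = 0 := fun y => by
        rw [hJ, ιInv_strictMap]
        exact Subtype.ext (c.h_i _)
      rw [hγ, ← J.comm, h2, h2, map_zero, add_zero]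
    rw [hπ', ιInv_strictMap, hψ, h1, hGJ]
    rfl
  have h_fst : ∀ x, strictMap (LinearMap.fst K V N) (e.fwd x) = G.toFun x := by
    refine LinearMap.congr_fun (f := strictMap (LinearMap.fst K V N) ∘ₗ e.fwd) ?_
    refine ((isCohom_strictMap _).comp e.isCohom).ext G.isCohom (LinearMap.ext fun x => ?_)
    simp only [LinearMap.comp_apply]
    rw [ιInv_strictMap, hπ']
    rfl
  -- In the new coordinates the components of the codifferential are `ψ D = (π p G, dC γ)`: the
  -- first depends only on the `V`-letters and the second only on the `N`-letters.
  have hS : ∀ y, TensorAlgebra.ιInv (S.d y) =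
      (TensorAlgebra.ιInv (p.d (strictMap (LinearMap.fst K V N) y)),
        TensorAlgebra.ιInv (n.d (strictMap (LinearMap.snd K V N) y))) := by
    intro y
    obtain ⟨x, rfl⟩ : ∃ x, e.fwd x = y := ⟨e.inv y, e.fwd_inv y⟩
    have h1 : S.d (e.fwd x) = e.fwd (D.d x) := by
      change e.fwd (D.d (e.inv (e.fwd x))) = _
      rw [e.inv_fwd]
    rw [h1, hπ', hψ, h_fst, ← G.comm, ιInv_linearStructure_d, ιInv_strictMap, hπ']
    refine Prod.ext rfl ?_
    change γ (D.d x) = dC (γ x)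
    rw [hγ, hγ, D.square_zero, map_zero, map_zero, add_zero, map_add, dC_dC, zero_add]
  refine ⟨N, inferInstance, inferInstance, 𝒞, dec, n, S, I, e.symm.transportHom D, ?_, ?_, hI, ?_,
    ?_⟩
  -- On a cocycle of `ker q` the homotopy identity reads `m₁ h x = x`.
  · refine isLinearContractible_linearStructure dC_mem dC_dC fun x hx => ⟨hC x, Subtype.ext ?_⟩
    have h1 := c.homotopy (x : H)
    rw [show D.m₁ (x : H) = 0 from congrArg Subtype.val hx, show c.q (x : H) = 0 from x.2,
      map_zero, map_zero, add_zero, sub_zero] at h1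
    exact h1
  · intro j x
    change TensorAlgebra.ιInv (S.d (TensorAlgebra.tprod K _ j x)) =
      (TensorAlgebra.ιInv (p.d (TensorAlgebra.tprod K _ j fun i => (x i).1)),
        TensorAlgebra.ιInv (n.d (TensorAlgebra.tprod K _ j fun i => (x i).2)))
    rw [hS, ← word_ofFn, ← word_ofFn, ← word_ofFn, strictMap_word, strictMap_word, List.map_ofFn,
      List.map_ofFn]
    rfl
  · exact AInfHom.isIso_of_inverse (e.symm.transportInvHom_comp_hom D)
      (e.symm.transportHom_comp_inv D)
  · change J = ((e.symm.transportHom D).comp (e.symm.transportInvHom D)).comp J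
    rw [e.symm.transportHom_comp_inv, AInfHom.id_comp]

end Decomposition

end AInf

/-! ### Uniqueness, factorization and inverse -/

theorem corollary4p5
    {K : Type w} [Field K] [CharZero K]
    {H : Type u} [AddCommGroup H] [Module K H]
    (ℋ : ℤ → Submodule K H) [DirectSum.Decomposition ℋ] (m : AInf.AInfStructure ℋ)
    {V : Type v} [AddCommGroup V] [Module K V]
    (𝒱 : ℤ → Submodule K V) [DirectSum.Decomposition 𝒱] (p : AInf.AInfStructure 𝒱)
    (hp : p.IsMinimal) (F : AInf.AInfHom p m) (hF : F.IsQuasiIso) :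
    -- uniqueness: every other minimal model is isomorphic to the given one
    (∀ {V' : Type v'} [AddCommGroup V'] [Module K V']
        (𝒱' : ℤ → Submodule K V') [DirectSum.Decomposition 𝒱'] (p' : AInf.AInfStructure 𝒱')
        (_ : p'.IsMinimal) (F' : AInf.AInfHom p' m) (_ : F'.IsQuasiIso),
        ∃ E : AInf.AInfHom p p', E.IsIso) ∧
    -- factorization `F = F_dc ∘ ι` through a decomposed model with minimal part `(V, p)`
    (∃ (C : Type u) (_ : AddCommGroup C) (_ : Module K C)
        (𝒞 : ℤ → Submodule K C) (_ : DirectSum.Decomposition 𝒞)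
        (c : AInf.AInfStructure 𝒞) (D : AInf.AInfStructure (AInf.prodGrading 𝒱 𝒞))
        (I : AInf.AInfHom p D) (Fdc : AInf.AInfHom D m),
        c.IsLinearContractible ∧ D.IsDirectSum p c ∧ I.IsInclusion ∧ Fdc.IsIso ∧
          F = Fdc.comp I) ∧
    -- inverse quasi-isomorphism, which is moreover a strict left inverse
    (∃ G : AInf.AInfHom m p, G.IsInverseQuasiIso F ∧ G.comp F = AInf.AInfHom.id p) := by
  refine ⟨?_, ?_, ?_⟩
  · intro V' _ _ 𝒱' _ p' hp' F' hF'
    obtain ⟨G', hG'⟩ := AInf.AInfHom.exists_retraction hp' hF'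
    -- The retraction of the second model, composed with the first model, compares the two directly.
    refine ⟨G'.comp F, AInf.AInfHom.isIso_of_isMinimal hp hp' ?_⟩
    rw [AInf.AInfHom.IsQuasiIso, AInf.AInfHom.cohomologyMap_comp]
    exact (AInf.AInfHom.isInverseQuasiIso_of_comp_eq_id hF' hG').1.comp hF
  · obtain ⟨D, A, B, J, hAB, hBA, rfl, hs, ⟨c⟩⟩ := AInf.AInfHom.exists_strict_model hp hF
    obtain ⟨G, hG⟩ := AInf.AInfHom.exists_retraction_of_strict hp _ hs c
    obtain ⟨C, i1, i2, 𝒞, i3, n, S, I, A', hn, hS, hI, hA', hJ⟩ :=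
      AInf.AInfHom.exists_factorization_of_strict _ hs c G hG
    refine ⟨C, i1, i2, 𝒞, i3, n, S, I, A.comp A', hn, hS, hI,
      (AInf.AInfHom.isIso_of_inverse hBA hAB).comp hA', ?_⟩
    change F = A.comp (A'.comp I)
    rw [← hJ]
    change F = (A.comp B).comp F
    rw [hAB, AInf.AInfHom.id_comp]
  · obtain ⟨G, hG⟩ := AInf.AInfHom.exists_retraction hp hF
    exact ⟨G, AInf.AInfHom.isInverseQuasiIso_of_comp_eq_id hF hG, hG⟩
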